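/- Let $R$ be a UFD of characteristic $p>0$, let $R[x,y]$ and $R[y_0,y_1,y_2]$ be polynomial rings over $R$, let $0\neq a\in R$, and let $0\ne\theta(y)=\sum_{i\ge1}s_iy^i\in yR[y]$. Put $f:=ax+\theta(y)$ and let $0\neq F\in R[f]$. Let $\phi$ be the Nagata type automorphism, i.e. the $R$-automorphism of $R[x,y]$ given by $\phi(x)=x+a^{-1}(\theta(y)-\theta(y+aF))$ and $\phi(y)=y+aF$, and let $R[x,y]^\phi=\{g\in R[x,y]\mid\phi(g)=g\}$. Define $q:=y^p-(aF)^{p-1}y$, $\theta^*(y):=\sum_{i\ge1}s_{pi}y^i$, and let $d\in R$ be a greatest common divisor of $a$ and $\theta'(y)$ in $R[x,y]$ (one exists; any choice is allowed). Put $$b:=ad^{-1},\quad \rho(y):=\sum_{p\nmid i}t_iy^i\ \text{ with } t_i:=s_id^{-1},\quad \rho^p(y):=\sum_{p\nmid i}t_i^py^i,$$ $$q_1:=d^{-1}(f-\theta^*(q)),\qquad \widetilde q_1:=b^{1-p}(q_1^p-\rho^p(q)).$$ Then $b\in R$, $\rho\in R[y]$ and $q_1,\widetilde q_1\in R[x,y]$;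 there exists a polynomial $\lambda$ in two variables over $R$ with $\rho'(y)^p\,y=\lambda(y^p,\rho(y))$; and there exists a polynomial $\nu$ in two variables over $R$ with $(dF)^{p-1}=\nu(q,q_1)$. For every such choice of $\lambda$ and $\nu$, the element $$q_2:=b^{-1}\bigl(\widetilde q_1-\lambda(q,q_1)(dF)^{p-1}\bigr)$$ lies in $R[x,y]$, the elements $q,q_1,q_2$ are $\phi$-invariant, and: 1. $R[x,y]^\phi=R[q,q_1,q_2]$. 2. The kernel of the substitution map $\sigma:R[y_0,y_1,y_2]\to R[x,y]^\phi$, $h(y_0,y_1,y_2)\mapsto h(q,q_1,q_2)$, is the principal ideal generated by $$\Lambda:=b^py_2+\rho^p(y_0)-y_1^p+b^{p-1}\lambda(y_0,y_1)\nu(y_0,y_1).$$ 3. Hence $R[x,y]^\phi\cong R[y_0,y_1,y_2]/(\Lambda)$ as $R$-algebras. -/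

import Mathlib

open Polynomial

noncomputable section

namespace Nagata

variable {R : Type*} [CommRing R]

/-- The polynomial ring `R[x, y]` in two variables. -/
abbrev Poly2 (R : Type*) [CommRing R] : Type _ := MvPolynomial (Fin 2) R

/-- The polynomial ring `R[y₀, y₁, y₂]` in three variables. -/
abbrev Poly3 (R : Type*) [CommRing R] : Type _ := MvPolynomial (Fin 3) R

/-- The variable `x` of `R[x, y]`. -/
def x (R : Type*) [CommRing R] : Poly2 R := MvPolynomial.X 0

/-- The variable `y` of `R[x, y]`. -/
def y (R : Type*) [CommRing R] : Poly2 R := MvPolynomial.X 1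

/-- `f = a x + θ(y)`. -/
def f (a : R) (θ : R[X]) : Poly2 R := MvPolynomial.C a * x R + aeval (y R) θ

/-- `a⁻¹ (θ(y + a F) - θ(y))`, an element of `R[x, y]`, written out through the Taylor expansion
`θ(y + U) = ∑ θᵢ(y) Uⁱ`, in which `θᵢ` is the `i`-th Hasse derivative of `θ`
(see `C_mul_quot`). -/
def quot (a : R) (θ : R[X]) (F : Poly2 R) : Poly2 R :=
  ∑ i ∈ Finset.range θ.natDegree,
    aeval (y R) (hasseDeriv (i + 1) θ) * MvPolynomial.C a ^ i * F ^ (i + 1)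

/-- The `R`-algebra endomorphism `x ↦ x + a⁻¹ (θ(y) - θ(y + a F))`, `y ↦ y + a F`. -/
def hom (a : R) (θ : R[X]) (F : Poly2 R) : Poly2 R →ₐ[R] Poly2 R :=
  MvPolynomial.aeval ![x R - quot a θ F, y R + MvPolynomial.C a * F]

theorem map_hasseDeriv {S : Type*} [CommRing S] (g : R →+* S) (k : ℕ) (P : R[X]) :
    hasseDeriv k (P.map g) = (hasseDeriv k P).map g := by
  ext n
  simp [hasseDeriv_coeff]

theorem C_mul_quot (a : R) (θ : R[X]) (F : Poly2 R) :
    MvPolynomial.C a * quot a θ F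
      = aeval (y R + MvPolynomial.C a * F) θ - aeval (y R) θ := by
  have h : aeval (y R + MvPolynomial.C a * F) θ
      = ∑ i ∈ Finset.range (θ.natDegree + 1),
          aeval (y R) (hasseDeriv i θ) * (MvPolynomial.C a * F) ^ i := by
    have h1 : aeval (y R + MvPolynomial.C a * F) θ
        = (taylor (y R) (θ.map (algebraMap R (Poly2 R)))).eval (MvPolynomial.C a * F) := by
      rw [taylor_eval, eval_map_algebraMap, add_comm]
    rw [h1, eval_eq_sum_range' (n := θ.natDegree + 1)]
    · refine Finset.sum_congr rfl fun i _ => ?_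
      rw [taylor_coeff, map_hasseDeriv, eval_map_algebraMap]
    · rw [natDegree_taylor]
      exact Nat.lt_succ_of_le natDegree_map_le
  rw [h, Finset.sum_range_succ', quot, Finset.mul_sum]
  simp only [hasseDeriv_zero, LinearMap.id_coe, id_eq, pow_zero, mul_one, add_sub_cancel_right]
  refine Finset.sum_congr rfl fun i _ => ?_
  ring

theorem hom_x (a : R) (θ : R[X]) (F : Poly2 R) : hom a θ F (x R) = x R - quot a θ F := by
  simp [hom, x]

theorem hom_y (a : R) (θ : R[X]) (F : Poly2 R) :
    hom a θ F (y R) = y R + MvPolynomial.C a * F := by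
  simp [hom, y]

theorem hom_f (a : R) (θ : R[X]) (F : Poly2 R) : hom a θ F (f a θ) = f a θ := by
  have hC : hom a θ F (MvPolynomial.C a) = MvPolynomial.C a := (hom a θ F).commutes a
  rw [f, map_add, map_mul, hC, hom_x, ← aeval_algHom_apply, hom_y, mul_sub, C_mul_quot]
  ring

theorem hom_of_mem (a : R) (θ : R[X]) (F : Poly2 R) {G : Poly2 R}
    (hG : G ∈ Algebra.adjoin R {f a θ}) : hom a θ F G = G := by
  have h : Algebra.adjoin R {f a θ}
      ≤ AlgHom.equalizer (hom a θ F) (AlgHom.id R (Poly2 R)) := by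
    rw [Algebra.adjoin_le_iff, Set.singleton_subset_iff]
    exact hom_f a θ F
  exact h hG

theorem hom_comp_neg [IsDomain R] {a : R} (ha : a ≠ 0) (θ : R[X]) {F : Poly2 R}
    (hF : F ∈ Algebra.adjoin R {f a θ}) :
    (hom a θ (-F)).comp (hom a θ F) = AlgHom.id R (Poly2 R) := by
  have hy : hom a θ (-F) (hom a θ F (y R)) = y R := by
    have hC : hom a θ (-F) (MvPolynomial.C a) = MvPolynomial.C a := (hom a θ (-F)).commutes a
    rw [hom_y, map_add, map_mul, hC, hom_y, hom_of_mem a θ (-F) hF]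
    ring
  have hx : hom a θ (-F) (hom a θ F (x R)) = x R := by
    have hCa : (MvPolynomial.C a : Poly2 R) ≠ 0 := by simpa using ha
    have hC : ((hom a θ (-F)).comp (hom a θ F)) (MvPolynomial.C a) = MvPolynomial.C a :=
      ((hom a θ (-F)).comp (hom a θ F)).commutes a
    have hf : ((hom a θ (-F)).comp (hom a θ F)) (f a θ) = f a θ := by
      rw [AlgHom.comp_apply, hom_f, hom_f]
    rw [f, map_add, map_mul, hC, ← aeval_algHom_apply, AlgHom.comp_apply, AlgHom.comp_apply,
      hy] at hf
    exact mul_left_cancel₀ hCa (add_right_cancel hf)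
  refine MvPolynomial.algHom_ext fun i => ?_
  fin_cases i
  · exact hx
  · exact hy

/-- The Nagata type automorphism `φ` of `R[x, y]` over `R`:
`φ(x) = x + a⁻¹ (θ(y) - θ(y + a F))` and `φ(y) = y + a F`, where `F ∈ R[f]`. -/
def aut [IsDomain R] (a : R) (ha : a ≠ 0) (θ : R[X]) (F : Poly2 R)
    (hF : F ∈ Algebra.adjoin R {f a θ}) : Poly2 R ≃ₐ[R] Poly2 R :=
  AlgEquiv.ofAlgHom (hom a θ F) (hom a θ (-F))
    (by simpa using hom_comp_neg ha θ (F := -F) (neg_mem hF)) (hom_comp_neg ha θ hF)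

/-- The invariant ring `R[x, y]^φ = {g | φ(g) = g}`. -/
def invariants (φ : Poly2 R ≃ₐ[R] Poly2 R) : Subalgebra R (Poly2 R) :=
  AlgHom.equalizer (φ : Poly2 R →ₐ[R] Poly2 R) (AlgHom.id R (Poly2 R))

/-- `q = y^p - (a F)^(p-1) y`. -/
def q (p : ℕ) (a : R) (F : Poly2 R) : Poly2 R :=
  y R ^ p - (MvPolynomial.C a * F) ^ (p - 1) * y R

/-- `d` is a greatest common divisor of `a` and `θ'(y)` in `R[x, y]`
(it is unique up to a unit of `R`). -/
def IsGcd (a : R) (θ : R[X]) (d : R) : Prop :=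
  ∀ e : Poly2 R, e ∣ MvPolynomial.C d ↔
    e ∣ MvPolynomial.C a ∧ e ∣ aeval (y R) (derivative θ)

/-- `ρ = ∑_{p ∤ i} tᵢ Tⁱ` with `tᵢ = sᵢ / d`, where `θ = ∑ sᵢ Tⁱ`. -/
def IsRho (p : ℕ) (θ : R[X]) (d : R) (ρ : R[X]) : Prop :=
  (∀ i, ¬ p ∣ i → d * ρ.coeff i = θ.coeff i) ∧ ∀ i, p ∣ i → ρ.coeff i = 0

/-- `θ* = ∑_{i ≥ 1} s_{p i} Tⁱ`, where `θ = ∑ sᵢ Tⁱ`. -/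
def thetaStar (p : ℕ) (θ : R[X]) : R[X] :=
  ∑ i ∈ Finset.Icc 1 θ.natDegree, C (θ.coeff (p * i)) * X ^ i

/-- `ρ^p = ∑ tᵢ^p Tⁱ` for `ρ = ∑ tᵢ Tⁱ`: the coefficients (only) are raised to the power `p`. -/
def coeffPow (p : ℕ) (ρ : R[X]) : R[X] :=
  ∑ i ∈ Finset.range (ρ.natDegree + 1), C (ρ.coeff i ^ p) * X ^ i

/-- `Λ = b^p y₂ + ρ^p(y₀) - y₁^p + b^(p-1) λ(y₀, y₁) ν(y₀, y₁)`. -/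
def Lambda (p : ℕ) (b : R) (ρ : R[X]) (lam nu : MvPolynomial (Fin 2) R) : Poly3 R :=
  MvPolynomial.C (b ^ p) * MvPolynomial.X 2 + aeval (MvPolynomial.X 0) (coeffPow p ρ)
    - MvPolynomial.X 1 ^ p
    + MvPolynomial.C (b ^ (p - 1))
      * MvPolynomial.aeval ![MvPolynomial.X 0, MvPolynomial.X 1] lam
      * MvPolynomial.aeval ![MvPolynomial.X 0, MvPolynomial.X 1] nu

end Nagata

end

namespace Nagata

/-! After inverting `a` the ring is polynomial in `y` over the coefficient ring generated by `f`,
and φ is the translation `y ↦ y + aF` with `F` in that coefficient ring. Translation-invariant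
polynomials are polynomials in `q` (`comp_eq_of_comp_X_add_C_eq`), so every invariant `g` satisfies
`a^N g ∈ R[f, q] ⊆ R[q, q₁, q₂]` for some `N` (`exists_C_pow_mul_mem_of_hom_eq`). The work lies in
removing `a^N`, one prime factor `ϖ` at a time, which is where unique factorization enters
(`mem_range_of_C_mul_mem_range`).

One factor can be removed once every relation modulo `ϖ` among `q, q₁, q₂` is a multiple of `Λ`
modulo `ϖ`: if `ϖ ∣ h(q, q₁, q₂)`, then `h = Λk + ϖh'`, and `Λ` vanishes at the generators
(`exists_aeval_eq_C_mul`). With `z = x + w`, the generators have the shape `q₁ = ρ(y) + bz` and `q₂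
= z^p + αz + β + bm`, where `w, α, β ∈ R[f, y]` become polynomials in `y` modulo `ϖ`, and `q`
becomes `y^p`. If `ϖ ∣ b`, then `q₂` is monic of degree `p` in `x` modulo `ϖ`, so the relations come
from those between `y^p` and `ρ(y)`. By the choice of `d`, `ρ'` is nonzero modulo `ϖ`;
differentiation then shows that `ρ(y)` has degree `p` over the polynomials in `y^p`, and `Λ` reduces
to its equation up to sign (`X_pow_sub_dvd_of_aeval_eq_zero`). If `ϖ ∤ b`, then `q` and `q₁` remain
algebraically independent and `Λ` has degree one in `y₂`, so division by `Λ` decides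
(`Lambda_dvd_of_aeval_eq_zero`). The same division over `R` gives the kernel.

That `λ` exists is a separate fact on one-variable polynomials in characteristic `p`
(`derivative_pow_mul_mem`). -/

/-! ### Existence of λ: multiples of `ρ'^(p-1)` as polynomials in `X^p` and `ρ` -/

/-- The functional on `A[T]` that is linear over `A` and sends `T ^ n` to `s ^ (n / p)` if
`n % p = p - 1`, and to `0` otherwise: the coefficient of `T ^ (p - 1)` modulo `T ^ p - s`. -/
noncomputable def topCoeff {A : Type*} [CommRing A] (p : ℕ) (s : A) : A[X] →ₗ[A] A :=
  Polynomial.lsum fun n => LinearMap.mulRight A (if n % p = p - 1 then s ^ (n / p) else 0)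

theorem topCoeff_C_mul_X_pow {A : Type*} [CommRing A] (p : ℕ) (s c : A) (n : ℕ) :
    topCoeff p s (C c * X ^ n) = c * if n % p = p - 1 then s ^ (n / p) else 0 := by
  rw [topCoeff, Polynomial.lsum_apply, C_mul_X_pow_eq_monomial, sum_monomial_index] <;> simp

theorem topCoeff_C_mul {A : Type*} [CommRing A] (p : ℕ) (s c : A) (P : A[X]) :
    topCoeff p s (C c * P) = c * topCoeff p s P := by
  rw [← smul_eq_C_mul, map_smul, smul_eq_mul]

theorem topCoeff_sub_mul {A : Type*} [CommRing A] {p : ℕ} (hp : 0 < p) (s : A) (P : A[X]) :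
    topCoeff p s ((X ^ p - C s) * P) = 0 := by
  induction P using Polynomial.induction_on' with
  | add P Q hP hQ => rw [mul_add, map_add, hP, hQ, add_zero]
  | monomial n c =>
    have h : (X ^ p - C s) * monomial n c = C c * X ^ (n + p) - C (s * c) * X ^ n := by
      rw [← C_mul_X_pow_eq_monomial, C_mul]; ring
    rw [h, map_sub, topCoeff_C_mul_X_pow, topCoeff_C_mul_X_pow, Nat.add_mod_right,
      Nat.add_div_right _ hp]
    split_ifs
    · rw [pow_succ]; ring
    · ring

theorem topCoeff_map_C_mem {R : Type*} [CommRing R] (p : ℕ) (P : R[X]) :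
    topCoeff p (X ^ p : R[X]) (P.map C) ∈ Algebra.adjoin R {(X ^ p : R[X])} := by
  induction P using Polynomial.induction_on' with
  | add P Q hP hQ => rw [Polynomial.map_add, map_add]; exact add_mem hP hQ
  | monomial n c =>
    rw [map_monomial, ← C_mul_X_pow_eq_monomial, topCoeff_C_mul_X_pow]
    refine mul_mem (Subalgebra.algebraMap_mem _ c) ?_
    split_ifs
    · exact pow_mem (Algebra.self_mem_adjoin_singleton R _) _
    · exact zero_mem _

/-- The functional applied to `P T^j` picks out the part of `P` with exponents congruent to `p - 1 -
j` modulo `p`; the factor `X^(p-1-j)` restores it. On a monomial only one `j` contributes. -/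
theorem sum_topCoeff_mul {R : Type*} [CommRing R] {p : ℕ} (hp : 0 < p) (P : R[X]) :
    ∑ j ∈ Finset.range p, topCoeff p (X ^ p : R[X]) (P.map C * X ^ j) * X ^ (p - 1 - j) = P := by
  induction P using Polynomial.induction_on' with
  | add P Q hP hQ =>
    simp only [Polynomial.map_add, add_mul, map_add, Finset.sum_add_distrib]
    rw [hP, hQ]
  | monomial n c =>
    have hlt := Nat.mod_lt n hp
    rw [Finset.sum_eq_single (p - 1 - n % p)]
    · have h1 : (n + (p - 1 - n % p)) % p = p - 1 := by
        rw [Nat.add_mod, Nat.mod_eq_of_lt (a := p - 1 - n % p) (by omega),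
          Nat.mod_eq_of_lt (by omega)]
        omega
      have h2 : (n + (p - 1 - n % p)) / p = n / p := by
        have e : n + (p - 1 - n % p) = (p - 1) + p * (n / p) := by
          have := Nat.mod_add_div n p
          omega
        rw [e, Nat.add_mul_div_left _ _ hp, Nat.div_eq_of_lt (by omega), zero_add]
      rw [map_monomial, ← C_mul_X_pow_eq_monomial, mul_assoc, ← pow_add, topCoeff_C_mul_X_pow,
        if_pos h1, h2, mul_assoc, ← pow_mul, ← pow_add, ← C_mul_X_pow_eq_monomial]
      congr 2
      have := Nat.mod_add_div n p
      omega
    · intro j hj hne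
      rw [Finset.mem_range] at hj
      rw [map_monomial, ← C_mul_X_pow_eq_monomial, mul_assoc, ← pow_add, topCoeff_C_mul_X_pow,
        if_neg, mul_zero, zero_mul]
      intro h
      rw [Nat.add_mod, Nat.mod_eq_of_lt hj] at h
      by_cases h' : n % p + j < p
      · rw [Nat.mod_eq_of_lt h'] at h; omega
      · rw [Nat.mod_eq_sub_mod (by omega), Nat.mod_eq_of_lt (by omega)] at h; omega
    · intro h
      exact absurd (Finset.mem_range.2 (by omega)) h

/-- After multiplication by `u - v` both sides become `u^p - v^p`, by Frobenius and by the geometric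
sum. -/
theorem sub_pow_pred_eq_sum {A : Type*} [CommRing A] [IsDomain A] (p : ℕ) [Fact p.Prime]
    [CharP A p] {u v : A} (h : u ≠ v) :
    (u - v) ^ (p - 1) = ∑ j ∈ Finset.range p, u ^ j * v ^ (p - 1 - j) := by
  have hp : 0 < p := (Fact.out : p.Prime).pos
  apply mul_right_cancel₀ (sub_ne_zero.2 h)
  rw [geom_sum₂_mul, ← sub_pow_char, ← pow_succ, Nat.sub_add_cancel hp]

theorem exists_aeval_add_eq {R T : Type*} [CommRing R] [CommRing T] [Algebra R T]
    (A : Subalgebra R T) (P : R[X]) {s u : T} (hs : s ∈ A) (hu : u ∈ A) :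
    ∃ k ∈ A, aeval (s + u) P = aeval s P + aeval s (derivative P) * u + k * u ^ 2 := by
  obtain ⟨k, hk⟩ := binomExpansion (P.map (algebraMap R A)) ⟨s, hs⟩ ⟨u, hu⟩
  refine ⟨k, k.2, ?_⟩
  simp only [derivative_map, eval_map_algebraMap] at hk
  have h := congrArg A.val hk
  simp only [map_add, map_mul, map_pow, ← aeval_algHom_apply] at h
  exact h

/-- In a second variable `T`, `(ρ(T) - ρ(X))^(p-1)` is congruent to `ρ'(X)^(p-1) (T - X)^(p-1)`
modulo `(T - X)^p = T^p - X^p`. Expand both powers as sums, multiply by `g(T)` and take the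
coefficient of `T^(p-1)` modulo `T^p - X^p`: the right side gives `ρ'^(p-1) g`, the left side a
polynomial in `X^p` and `ρ`. Taking `g = ρ' X` yields `λ`. -/
theorem derivative_pow_mul_mem {R : Type*} [CommRing R] [IsDomain R] (p : ℕ) [Fact p.Prime]
    [CharP R p] (ρ g : R[X]) :
    derivative ρ ^ (p - 1) * g ∈ Algebra.adjoin R {(X ^ p : R[X]), ρ} := by
  have hp : p.Prime := Fact.out
  by_cases h0 : derivative ρ = 0
  · rw [h0, zero_pow (by have := hp.two_le; omega), zero_mul]
    exact zero_mem _
  obtain ⟨k, -, hk⟩ := exists_aeval_add_eq (⊤ : Subalgebra R R[X][X]) ρ (s := C X)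
    (u := X - C X) trivial trivial
  have hC : ∀ P : R[X], aeval (C X : R[X][X]) P = C P := fun P => by
    have := aeval_algHom_apply (CAlgHom (R := R) (A := R[X])) X P
    simpa using this
  have hX : ∀ P : R[X], aeval (X : R[X][X]) P = P.map C := fun P => by
    rw [aeval_def]; rfl
  rw [add_sub_cancel, hC, hC, hX] at hk
  -- If `ρ(T) = ρ(X)`, cancelling `T - X` in the Taylor expansion and setting `T = X` gives `ρ' =
  -- 0`.
  have hne : ρ.map C ≠ C ρ := by
    intro h
    rw [h] at hk
    have h1 : (X - C X) * (C (derivative ρ) + k * (X - C X)) = 0 := by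
      linear_combination -hk
    rcases mul_eq_zero.1 h1 with h2 | h2
    · exact X_sub_C_ne_zero _ h2
    · have := congrArg (eval X) h2
      simp at this
      exact h0 this
  obtain ⟨G, hG⟩ := sub_dvd_pow_sub_pow (C (derivative ρ) + k * (X - C X)) (C (derivative ρ)) (p - 1)
  have hfr : (X - C X : R[X][X]) ^ p = X ^ p - C (X ^ p) := by
    rw [sub_pow_char, C_pow]
  have hpp : (X - C X : R[X][X]) ^ (p - 1) * (X - C X) = (X - C X) ^ p := by
    rw [← pow_succ, Nat.sub_add_cancel hp.pos]
  have key : (ρ.map C - C ρ) ^ (p - 1)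
      = C (derivative ρ ^ (p - 1)) * (X - C X) ^ (p - 1) + (X ^ p - C (X ^ p)) * (k * G) := by
    have e : ρ.map C - C ρ = (X - C X) * (C (derivative ρ) + k * (X - C X)) := by
      linear_combination hk
    rw [e, mul_pow, ← hfr, ← hpp, C_pow]
    linear_combination (X - C X : R[X][X]) ^ (p - 1) * hG
  have hXne : (X : R[X][X]) ≠ C X := fun h => X_sub_C_ne_zero (X : R[X]) (sub_eq_zero.2 h)
  rw [sub_pow_pred_eq_sum p hne, sub_pow_pred_eq_sum p hXne] at key
  have key2 := congrArg (fun P => topCoeff p (X ^ p : R[X]) (g.map C * P)) key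
  simp only [mul_add, map_add] at key2
  rw [show g.map C * ((X ^ p - C (X ^ p)) * (k * G)) = (X ^ p - C (X ^ p)) * (g.map C * (k * G)) by
    ring, topCoeff_sub_mul hp.pos, add_zero, mul_left_comm, topCoeff_C_mul] at key2
  have e2 : topCoeff p (X ^ p : R[X]) (g.map C * ∑ j ∈ Finset.range p, X ^ j * C X ^ (p - 1 - j))
      = g := by
    conv_rhs => rw [← sum_topCoeff_mul hp.pos g]
    rw [Finset.mul_sum, map_sum]
    refine Finset.sum_congr rfl fun j _ => ?_
    rw [← C_pow, mul_comm (_ ^ j), mul_left_comm, topCoeff_C_mul, mul_comm]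
  rw [e2] at key2
  rw [← key2, Finset.mul_sum, map_sum]
  refine sum_mem fun j _ => ?_
  rw [← C_pow, mul_comm (_ ^ j), mul_left_comm, topCoeff_C_mul, ← Polynomial.map_pow,
    ← Polynomial.map_mul]
  refine mul_mem (pow_mem (Algebra.subset_adjoin (by simp)) _) ?_
  exact Algebra.adjoin_mono (by simp) (topCoeff_map_C_mem p _)

/-! ### Polynomials invariant under a translation -/

/-- Division by the monic invariant polynomial `Q = X^p - c^(p-1) X` commutes with the translation,
so quotient and remainder are again invariant and induction on the degree applies. In degree below
`p`, an invariant polynomial takes the same value at the `p` distinct points `kc` and is constant.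
-/
theorem comp_eq_of_comp_X_add_C_eq {S : Type*} [CommRing S] [IsDomain S] (p : ℕ) [Fact p.Prime]
    [CharP S p] {c : S} (hc : c ≠ 0) (G : S[X]) (hG : G.comp (X + C c) = G) :
    ∃ H : S[X], G = H.comp (X ^ p - C (c ^ (p - 1)) * X) := by
  have hp : p.Prime := Fact.out
  have h2 := hp.two_le
  set Q : S[X] := X ^ p - C (c ^ (p - 1)) * X with hQ
  have hdeg : (C (c ^ (p - 1)) * X : S[X]).degree < p := by
    refine lt_of_le_of_lt (degree_C_mul_X_le _) ?_
    exact_mod_cast hp.one_lt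
  have hmon : Q.Monic := monic_X_pow_sub hdeg
  have hnd : Q.natDegree = p := by
    refine natDegree_eq_of_degree_eq_some ?_
    rw [hQ, degree_sub_eq_left_of_degree_lt (by rwa [degree_X_pow]), degree_X_pow]
  have hQc : Q.comp (X + C c) = Q := by
    have e : C c ^ p = C c ^ (p - 1) * C c := by rw [← pow_succ, Nat.sub_add_cancel hp.pos]
    simp only [hQ, sub_comp, mul_comp, pow_comp, X_comp, C_comp, add_pow_char, C_pow]
    rw [e]; ring
  induction hn : G.natDegree using Nat.strong_induction_on generalizing G with
  | _ n ih =>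
  by_cases hlt : G.natDegree < p
  · refine ⟨C (G.eval 0), ?_⟩
    rw [C_comp]
    have hk : ∀ k : ℕ, G.eval ((k : S) * c) = G.eval 0 := by
      intro k
      induction k with
      | zero => simp
      | succ k ihk =>
        rw [← ihk]
        conv_rhs => rw [← hG]
        simp [eval_comp, add_mul]
    have hinj : Function.Injective fun i : Fin p => ((i : ℕ) : S) * c := by
      intro i j hij
      have := mul_right_cancel₀ hc hij
      rw [CharP.natCast_eq_natCast S p, Nat.ModEq, Nat.mod_eq_of_lt i.2, Nat.mod_eq_of_lt j.2] at this
      exact Fin.ext this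
    refine eq_of_natDegree_lt_card_of_eval_eq _ _ hinj (fun i => ?_) ?_
    · simp [hk]
    · simpa using hlt
  · push Not at hlt
    have hu := div_modByMonic_unique (f := G) ((G /ₘ Q).comp (X + C c)) ((G %ₘ Q).comp (X + C c))
      hmon ⟨by
        have := congrArg (fun P => P.comp (X + C c)) (modByMonic_add_div G Q)
        simp only [add_comp, mul_comp, hQc, hG] at this
        exact this, by
        refine lt_of_le_of_lt ?_ (degree_modByMonic_lt G hmon)
        rw [degree_le_iff_coeff_zero] 
        intro m hm
        by_cases h0 : G %ₘ Q = 0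
        · simp [h0]
        apply coeff_eq_zero_of_natDegree_lt
        rw [natDegree_comp, natDegree_X_add_C, mul_one]
        rw [degree_eq_natDegree h0] at hm
        exact_mod_cast hm⟩
    obtain ⟨H1, hH1⟩ := ih (G /ₘ Q).natDegree (by
      rw [natDegree_divByMonic G hmon]; omega) (G /ₘ Q) hu.1.symm rfl
    obtain ⟨H2, hH2⟩ := ih (G %ₘ Q).natDegree (by
      have := natDegree_modByMonic_lt G hmon (fun h => by rw [h] at hnd; simp at hnd; omega)
      omega) (G %ₘ Q) hu.2.symm rfl
    refine ⟨H2 + X * H1, ?_⟩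
    rw [add_comp, mul_comp, X_comp, ← hH1, ← hH2, modByMonic_add_div G Q]

/-- First-order Taylor expansion in two variables, used to compare `λ(q, q₁)` with `λ(y^p, ρ(y))`
modulo `b²`. -/
theorem exists_aeval_add_mul_eq {R T : Type*} [CommRing R] [CommRing T] [Algebra R T]
    (s r u z b : T) (lam : MvPolynomial (Fin 2) R) :
    ∃ m : T, MvPolynomial.aeval ![s + b * u, r + b * z] lam
      = MvPolynomial.aeval ![s, r] lam
        + b * (u * MvPolynomial.aeval ![s, r] (MvPolynomial.pderiv 0 lam)
          + z * MvPolynomial.aeval ![s, r] (MvPolynomial.pderiv 1 lam)) + b ^ 2 * m := by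
  induction lam using MvPolynomial.induction_on with
  | C c => exact ⟨0, by simp⟩
  | add P Q hP hQ =>
    obtain ⟨m, hm⟩ := hP
    obtain ⟨n, hn⟩ := hQ
    refine ⟨m + n, ?_⟩
    simp only [map_add, hm, hn]
    ring
  | mul_X P i hP =>
    obtain ⟨m, hm⟩ := hP
    fin_cases i
    · refine ⟨m * (s + b * u) + (u * MvPolynomial.aeval ![s, r] (MvPolynomial.pderiv 0 P)
          + z * MvPolynomial.aeval ![s, r] (MvPolynomial.pderiv 1 P)) * u, ?_⟩
      simp [hm, Derivation.leibniz, MvPolynomial.pderiv_X]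
      ring
    · refine ⟨m * (r + b * z) + (u * MvPolynomial.aeval ![s, r] (MvPolynomial.pderiv 0 P)
          + z * MvPolynomial.aeval ![s, r] (MvPolynomial.pderiv 1 P)) * z, ?_⟩
      simp [hm, Derivation.leibniz, MvPolynomial.pderiv_X]
      ring

/-! ### Division by Λ and the kernel of the substitution -/

/-- The factor is monic in `y₁`, hence a nonzerodivisor over any ring. No domain is assumed, since
`A` will be a quotient by an arbitrary `b`. The map `τ` isolates `y₁` as a polynomial variable and
has the left inverse `ε`. -/
theorem eq_zero_of_X_pow_sub_mul_eq_zero {A : Type*} [CommRing A] {p : ℕ} (hp : 0 < p) (P : A[X])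
    {h : Poly3 A} (hh : (MvPolynomial.X 1 ^ p - aeval (MvPolynomial.X 0) P) * h = 0) : h = 0 := by
  let τ : Poly3 A →ₐ[A] (Poly3 A)[X] :=
    MvPolynomial.aeval ![C (MvPolynomial.X 0), X, C (MvPolynomial.X 2)]
  let ε : (Poly3 A)[X] →ₐ[Poly3 A] Poly3 A := aeval (MvPolynomial.X 1)
  have hετ : ∀ g, ε (τ g) = g := by
    intro g
    have : (ε.restrictScalars A).comp τ = AlgHom.id A _ := by
      refine MvPolynomial.algHom_ext fun i => ?_
      fin_cases i <;> simp [τ, ε]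
    exact DFunLike.congr_fun this g
  have h1 := congrArg τ hh
  have hτ : τ (MvPolynomial.X 1 ^ p - aeval (MvPolynomial.X 0) P)
      = X ^ p - C (aeval (MvPolynomial.X 0) P) := by
    have e := aeval_algHom_apply (CAlgHom (R := A) (A := Poly3 A)) (MvPolynomial.X 0) P
    simp only [CAlgHom_apply] at e
    rw [map_sub, map_pow, ← aeval_algHom_apply, ← e]
    simp [τ]
  rw [map_mul, hτ, map_zero] at h1
  have h2 : τ h = 0 := by
    by_cases hs : Subsingleton A
    · exact Subsingleton.elim _ _
    rw [not_subsingleton_iff_nontrivial] at hs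
    have hmon : (X ^ p - C (aeval (MvPolynomial.X 0) P) : (Poly3 A)[X]).Monic :=
      monic_X_pow_sub_C _ hp.ne'
    exact (hmon.mul_right_eq_zero_iff).1 h1
  rw [← hετ h, h2, map_zero]

/-- Pseudo-division: modulo `b y₂ - c(y₀, y₁)`, each factor `y₂` can be traded for `c` at the cost
of one factor `b`. -/
theorem exists_C_pow_mul_eq {S : Type*} [CommRing S] (b : S) (c : MvPolynomial (Fin 2) S)
    (h : Poly3 S) : ∃ (N : ℕ) (G : Poly3 S) (r : MvPolynomial (Fin 2) S),
      MvPolynomial.C b ^ N * h = (MvPolynomial.C b * MvPolynomial.X 2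
        - MvPolynomial.aeval ![MvPolynomial.X 0, MvPolynomial.X 1] c) * G
        + MvPolynomial.aeval ![MvPolynomial.X 0, MvPolynomial.X 1] r := by
  induction h using MvPolynomial.induction_on with
  | C a => exact ⟨0, 0, MvPolynomial.C a, by simp⟩
  | add P Q hP hQ =>
    obtain ⟨N, G, r, h⟩ := hP
    obtain ⟨N', G', r', h'⟩ := hQ
    refine ⟨N + N', MvPolynomial.C b ^ N' * G + MvPolynomial.C b ^ N * G',
      MvPolynomial.C b ^ N' * r + MvPolynomial.C b ^ N * r', ?_⟩
    simp only [map_add, map_mul, map_pow, MvPolynomial.aeval_C, MvPolynomial.algebraMap_eq]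
    linear_combination MvPolynomial.C b ^ N' * h + MvPolynomial.C b ^ N * h'
  | mul_X P i hP =>
    obtain ⟨N, G, r, h⟩ := hP
    fin_cases i
    · refine ⟨N, G * MvPolynomial.X 0, r * MvPolynomial.X 0, ?_⟩
      simp [-MvPolynomial.aeval_eq_bind₁]
      linear_combination MvPolynomial.X 0 * h
    · refine ⟨N, G * MvPolynomial.X 1, r * MvPolynomial.X 1, ?_⟩
      simp [-MvPolynomial.aeval_eq_bind₁]
      linear_combination MvPolynomial.X 1 * h
    · refine ⟨N + 1, MvPolynomial.C b * MvPolynomial.X 2 * G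
        + MvPolynomial.aeval ![MvPolynomial.X 0, MvPolynomial.X 1] r, c * r, ?_⟩
      simp [-MvPolynomial.aeval_eq_bind₁]
      linear_combination MvPolynomial.C b * MvPolynomial.X 2 * h

theorem map_mk_eq_zero_iff {S σ : Type*} [CommRing S] (b : S) (g : MvPolynomial σ S) :
    MvPolynomial.map (Ideal.Quotient.mk (Ideal.span {b})) g = 0 ↔ MvPolynomial.C b ∣ g :=
  (MvPolynomial.C_dvd_iff_map_hom_eq_zero _ b
    (fun r' => by rw [Ideal.Quotient.eq_zero_iff_mem, Ideal.mem_span_singleton]) g).symm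

theorem map_aeval_eq {S T σ : Type*} [CommRing S] [CommRing T] (g : S →+* T)
    (s : MvPolynomial σ S) (P : S[X]) :
    MvPolynomial.map g (aeval s P) = aeval (MvPolynomial.map g s) (P.map g) := by
  rw [aeval_def, aeval_def, hom_eval₂, eval₂_map]
  congr 1
  ext r
  simp [MvPolynomial.algebraMap_eq]

theorem map_mvAeval_eq {S T σ τ : Type*} [CommRing S] [CommRing T] (g : S →+* T)
    (v : τ → MvPolynomial σ S) (P : MvPolynomial τ S) :
    MvPolynomial.map g (MvPolynomial.aeval v P)
      = MvPolynomial.aeval (fun i => MvPolynomial.map g (v i)) (MvPolynomial.map g P) := by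
  rw [MvPolynomial.aeval_def, MvPolynomial.aeval_def, MvPolynomial.eval₂_map,
    MvPolynomial.hom_eval₂]
  congr 1
  ext r
  simp [MvPolynomial.algebraMap_eq]

/-- Modulo `b`, and because `p - 1 > 0`, `Λ` reduces to `ρ^p(y₀) - y₁^p`, which is a nonzerodivisor.
-/
theorem C_dvd_of_C_dvd_Lambda_mul {S : Type*} [CommRing S] {p : ℕ} (hp : 2 ≤ p) (b : S) (ρ : S[X])
    (lam nu : MvPolynomial (Fin 2) S) {G : Poly3 S}
    (h : MvPolynomial.C b ∣ Lambda p b ρ lam nu * G) : MvPolynomial.C b ∣ G := by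
  rw [← map_mk_eq_zero_iff] at h ⊢
  have hb : Ideal.Quotient.mk (Ideal.span {b}) b = 0 := by
    rw [Ideal.Quotient.eq_zero_iff_mem]; exact Ideal.mem_span_singleton_self b
  refine eq_zero_of_X_pow_sub_mul_eq_zero (p := p) (by omega)
    ((coeffPow p ρ).map (Ideal.Quotient.mk (Ideal.span {b}))) ?_
  rw [map_mul, Lambda] at h
  simp only [map_add, map_sub, map_mul, map_pow, MvPolynomial.map_C, hb, map_aeval_eq,
    MvPolynomial.map_X, map_zero, zero_pow (show p ≠ 0 by omega),
    zero_pow (show p - 1 ≠ 0 by omega), zero_mul, zero_add, add_zero] at h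
  linear_combination -h

theorem Lambda_eq {S : Type*} [CommRing S] (p : ℕ) (b : S) (ρ : S[X])
    (lam nu : MvPolynomial (Fin 2) S) :
    Lambda p b ρ lam nu = MvPolynomial.C (b ^ p) * MvPolynomial.X 2
      - MvPolynomial.aeval ![MvPolynomial.X 0, MvPolynomial.X 1]
        (MvPolynomial.X 1 ^ p - aeval (MvPolynomial.X 0) (coeffPow p ρ)
          - MvPolynomial.C (b ^ (p - 1)) * (lam * nu) : MvPolynomial (Fin 2) S) := by
  simp only [Lambda, map_sub, map_mul, ← aeval_algHom_apply, MvPolynomial.aeval_X, map_pow,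
    MvPolynomial.aeval_C, MvPolynomial.algebraMap_eq, Matrix.cons_val_zero, Matrix.cons_val_one]
  ring

/-- Pseudo-division leaves a remainder in `y₀, y₁` alone, which vanishes because `q` and `q₁` are
algebraically independent. Hence `Λ` divides a power of `b` times `h`, and the factors `b` cancel
one by one because `Λ` is a nonzerodivisor modulo `b`. -/
theorem Lambda_dvd_of_aeval_eq_zero {S T : Type*} [CommRing S] [IsDomain S] [CommRing T]
    [Algebra S T] {p : ℕ} (hp : 2 ≤ p) {b : S} (hb : b ≠ 0) (ρ : S[X])
    (lam nu : MvPolynomial (Fin 2) S) {q q₁ q₂ : T}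
    (hind : Function.Injective (MvPolynomial.aeval ![q, q₁] : MvPolynomial (Fin 2) S →ₐ[S] T))
    (hΛ : MvPolynomial.aeval ![q, q₁, q₂] (Lambda p b ρ lam nu) = 0) {h : Poly3 S}
    (hh : MvPolynomial.aeval ![q, q₁, q₂] h = 0) : Lambda p b ρ lam nu ∣ h := by
  obtain ⟨N, G, r, e⟩ := exists_C_pow_mul_eq (b ^ p) (MvPolynomial.X 1 ^ p
    - aeval (MvPolynomial.X 0) (coeffPow p ρ) - MvPolynomial.C (b ^ (p - 1)) * (lam * nu)) h
  rw [← Lambda_eq] at e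
  have hr : r = 0 := by
    apply hind
    have e1 := congrArg (MvPolynomial.aeval ![q, q₁, q₂]) e
    have e2 : MvPolynomial.aeval ![q, q₁, q₂] (MvPolynomial.aeval
        ![(MvPolynomial.X 0 : Poly3 S), MvPolynomial.X 1] r) = MvPolynomial.aeval ![q, q₁] r := by
      rw [← AlgHom.comp_apply]
      congr 1
      refine MvPolynomial.algHom_ext fun i => ?_
      fin_cases i <;> simp
    rw [map_mul, map_add, map_mul, hh, hΛ, e2, mul_zero, zero_mul, zero_add] at e1
    rw [← e1, map_zero]
  rw [hr, map_zero, add_zero, MvPolynomial.C_pow, ← pow_mul] at e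
  have key : ∀ (n : ℕ) (G : Poly3 S), MvPolynomial.C b ^ n * h = Lambda p b ρ lam nu * G →
      Lambda p b ρ lam nu ∣ h := by
    intro n
    induction n with
    | zero => intro G hG; exact ⟨G, by simpa using hG⟩
    | succ n ih =>
      intro G hG
      obtain ⟨G', rfl⟩ := C_dvd_of_C_dvd_Lambda_mul hp b ρ lam nu
        (G := G) (Dvd.intro (MvPolynomial.C b ^ n * h) (by rw [← hG, pow_succ]; ring))
      refine ih G' (mul_left_cancel₀ (a := MvPolynomial.C b) (by simpa using hb) ?_)
      rw [← mul_assoc, ← pow_succ', hG]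
      ring
  exact key _ G e

/-- The transcendence degree is two, so two elements over which everything is algebraic form a
transcendence basis. -/
theorem injective_aeval_of_isAlgebraic {S : Type*} [CommRing S] [IsDomain S] (u v : Poly2 S)
    (hx : IsAlgebraic (Algebra.adjoin S (Set.range ![u, v])) (x S))
    (hy : IsAlgebraic (Algebra.adjoin S (Set.range ![u, v])) (y S)) :
    Function.Injective (MvPolynomial.aeval ![u, v] : MvPolynomial (Fin 2) S →ₐ[S] Poly2 S) := by
  have : Algebra.IsAlgebraic (Algebra.adjoin S (Set.range ![u, v])) (Poly2 S) := by
    refine ⟨fun g => ?_⟩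
    induction g using MvPolynomial.induction_on with
    | C c => exact isAlgebraic_algebraMap (algebraMap S (Algebra.adjoin S (Set.range ![u, v])) c)
    | add P Q hP hQ => exact hP.add hQ
    | mul_X P i hP =>
      refine hP.mul ?_
      fin_cases i
      · exact hx
      · exact hy
  exact (Algebra.IsAlgebraic.isTranscendenceBasis_of_lift_le_trdeg_of_finite S ![u, v]
    (by simp)).1


/-! ### Relations between `y^p` and `ρ(y)` in characteristic `p` -/

theorem coeffPow_eq_map_frobenius {S : Type*} [CommRing S] (p : ℕ) [Fact p.Prime] [CharP S p]
    (ρ : S[X]) : coeffPow p ρ = ρ.map (frobenius S p) := by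
  have hp : p.Prime := Fact.out
  ext n
  simp only [coeffPow, finsetSum_coeff, coeff_C_mul, coeff_X_pow, coeff_map, frobenius_def,
    mul_ite, mul_one, mul_zero]
  rw [Finset.sum_ite_eq]
  split_ifs with h
  · rfl
  · rw [coeff_eq_zero_of_natDegree_lt (by simpa using h), zero_pow hp.ne_zero]

theorem expand_coeffPow {S : Type*} [CommRing S] (p : ℕ) [Fact p.Prime] [CharP S p]
    (ρ : S[X]) : expand S p (coeffPow p ρ) = ρ ^ p := by
  rw [coeffPow_eq_map_frobenius, ← map_expand, map_frobenius_expand]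

/-- Polynomials in `X^p` have zero derivative, so differentiating `K(ρ) = 0` gives `ρ' K'(ρ) = 0`
and thus `K'(ρ) = 0`. By induction on the degree `K' = 0`; as the degree is below `p`, `K` is
constant, and `expand` is injective. -/
theorem eq_zero_of_eval₂_expand_eq_zero {S : Type*} [CommRing S] [IsDomain S] (p : ℕ)
    [Fact p.Prime] [CharP S p] {ρ : S[X]} (hρ : derivative ρ ≠ 0) (K : S[X][X])
    (hK : K.natDegree < p) (h : eval₂ (expand S p : S[X] →+* S[X]) ρ K = 0) : K = 0 := by
  have hp : p.Prime := Fact.out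
  have hder : ∀ K : S[X][X], derivative (eval₂ (expand S p : S[X] →+* S[X]) ρ K)
      = derivative ρ * eval₂ (expand S p : S[X] →+* S[X]) ρ (derivative K) := by
    intro K
    induction K using Polynomial.induction_on' with
    | add P Q hP hQ => simp only [eval₂_add, map_add, hP, hQ, mul_add]
    | monomial n c =>
      rw [eval₂_monomial, derivative_monomial, eval₂_monomial]
      have : derivative (expand S p c) = 0 := by
        rw [derivative_expand, CharP.cast_eq_zero]; simp
      simp [derivative_mul, derivative_pow, this]
      ring
  induction hn : K.natDegree using Nat.strong_induction_on generalizing K with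
  | _ n ih =>
  have hd := hder K
  rw [h, derivative_zero, eq_comm, mul_eq_zero, or_iff_right hρ] at hd
  have hC : K = C (K.coeff 0) := by
    by_cases h0 : K.natDegree = 0
    · exact eq_C_of_natDegree_eq_zero h0
    have hlt := natDegree_derivative_lt h0
    have h1 := ih _ (hn ▸ hlt) (derivative K) (hlt.trans hK) hd rfl
    refine absurd ?_ h0
    by_contra h2
    have h3 := congrArg (fun P => coeff P (K.natDegree - 1)) h1
    simp only [coeff_derivative, coeff_zero] at h3
    rw [Nat.sub_add_cancel (by omega)] at h3
    rcases mul_eq_zero.1 h3 with h4 | h4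
    · rw [coeff_natDegree, leadingCoeff_eq_zero] at h4
      exact h2 (by rw [h4, natDegree_zero])
    · rw [← Nat.cast_succ, CharP.cast_eq_zero_iff S[X] p] at h4
      have := Nat.le_of_dvd (by omega) h4
      omega
  rw [hC, eval₂_C] at h
  rw [hC, (expand_injective hp.pos (h.trans (map_zero _).symm) : K.coeff 0 = 0), C_0]

theorem X_pow_sub_dvd_of_eval₂_expand_eq_zero {S : Type*} [CommRing S] [IsDomain S] (p : ℕ)
    [Fact p.Prime] [CharP S p] {ρ : S[X]} (hρ : derivative ρ ≠ 0) (K : S[X][X])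
    (h : eval₂ (expand S p : S[X] →+* S[X]) ρ K = 0) : X ^ p - C (coeffPow p ρ) ∣ K := by
  have hp : p.Prime := Fact.out
  have hmon : (X ^ p - C (coeffPow p ρ)).Monic := monic_X_pow_sub_C _ hp.ne_zero
  have h0 : eval₂ (expand S p : S[X] →+* S[X]) ρ (X ^ p - C (coeffPow p ρ)) = 0 := by
    rw [eval₂_sub, eval₂_pow, eval₂_X, eval₂_C, RingHom.coe_coe, expand_coeffPow, sub_self]
  have hnd : (X ^ p - C (coeffPow p ρ)).natDegree = p := natDegree_X_pow_sub_C
  rw [← modByMonic_eq_zero_iff_dvd hmon]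
  refine eq_zero_of_eval₂_expand_eq_zero p hρ _ ?_ ?_
  · conv_rhs => rw [← hnd]
    refine natDegree_modByMonic_lt K hmon fun h1 => ?_
    rw [h1, natDegree_one] at hnd
    exact hp.ne_zero hnd.symm
  · rw [← modByMonic_add_div K (X ^ p - C (coeffPow p ρ)), eval₂_add, eval₂_mul, h0, zero_mul,
      add_zero] at h
    exact h

/-- The third argument has degree `p > 0` in `x`, so it satisfies no nonzero relation over the
polynomials in `y`. Each coefficient of `h` as a polynomial in `y₂` therefore vanishes at `(y^p,
ρ(y))` and is divisible by `y₁^p - ρ^p(y₀)`. -/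
theorem X_pow_sub_dvd_of_aeval_eq_zero {S : Type*} [CommRing S] [IsDomain S] (p : ℕ)
    [Fact p.Prime] [CharP S p] {ρ : S[X]} (hρ : derivative ρ ≠ 0) (w α β : S[X]) {h : Poly3 S}
    (hh : MvPolynomial.aeval ![y S ^ p, aeval (y S) ρ,
      (x S + aeval (y S) w) ^ p + aeval (y S) α * (x S + aeval (y S) w) + aeval (y S) β] h = 0) :
    MvPolynomial.X 1 ^ p - aeval (MvPolynomial.X 0) (coeffPow p ρ) ∣ h := by
  have hp : p.Prime := Fact.out
  let e2 : S[X][X] →+* S[X] := eval₂RingHom (expand S p : S[X] →+* S[X]) ρ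
  let Q : S[X][X] := (X + C w) ^ p + C α * (X + C w) + C β
  let Φ : Poly2 S →ₐ[S] S[X][X] := MvPolynomial.aeval ![X, C X]
  -- The nesting puts `y₀` innermost and `y₂` outermost.
  let Θ : S[X][X][X] →+* Poly3 S := eval₂RingHom (eval₂RingHom
    (aeval (MvPolynomial.X 0) : S[X] →ₐ[S] Poly3 S).toRingHom (MvPolynomial.X 1))
    (MvPolynomial.X 2)
  have hΘ : Function.Surjective Θ := by
    intro g
    induction g using MvPolynomial.induction_on with
    | C c => exact ⟨C (C (C c)), by simp [Θ, MvPolynomial.algebraMap_eq]⟩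
    | add P R hP hR =>
      obtain ⟨P', rfl⟩ := hP
      obtain ⟨R', rfl⟩ := hR
      exact ⟨P' + R', map_add _ _ _⟩
    | mul_X P i hP =>
      obtain ⟨P', rfl⟩ := hP
      fin_cases i
      · exact ⟨P' * C (C X), by rw [map_mul]; simp [Θ]⟩
      · exact ⟨P' * C X, by rw [map_mul]; simp [Θ]⟩
      · exact ⟨P' * X, by rw [map_mul]; simp [Θ]⟩
  have hΦ : ∀ P : S[X], Φ (aeval (y S) P) = C P := by
    intro P
    have e := aeval_algHom_apply (CAlgHom (R := S) (A := S[X])) X P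
    rw [← aeval_algHom_apply]
    simpa [Φ, y] using e
  obtain ⟨H, rfl⟩ := hΘ h
  have hcomp : (H.map e2).comp Q = 0 := by
    rw [← map_zero Φ, ← hh]
    have : ((eval₂RingHom C Q).comp (mapRingHom e2)) = (Φ : Poly2 S →+* S[X][X]).comp
        (((MvPolynomial.aeval ![y S ^ p, aeval (y S) ρ,
          (x S + aeval (y S) w) ^ p + aeval (y S) α * (x S + aeval (y S) w) + aeval (y S) β] :
            Poly3 S →ₐ[S] Poly2 S) : Poly3 S →+* Poly2 S).comp Θ) := by
      refine Polynomial.ringHom_ext' (Polynomial.ringHom_ext' (Polynomial.ringHom_ext' ?_ ?_) ?_) ?_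
      · ext r; simp [e2, Θ, MvPolynomial.algebraMap_eq, Φ]
      · simp [e2, Θ, Φ, y, eval₂_pow]
      · simp [e2, Θ, hΦ]
      · simp [e2, Θ, hΦ, Q]; simp [Φ, x]
    exact DFunLike.congr_fun this H
  have hQ : Q.natDegree = p := by
    have h1 : (C α * (X + C w) + C β).natDegree ≤ 1 := by compute_degree
    have h2 : ((X + C w) ^ p).natDegree = p := by
      rw [natDegree_pow, natDegree_X_add_C, mul_one]
    rw [show Q = (X + C w) ^ p + (C α * (X + C w) + C β) from add_assoc _ _ _,
      natDegree_add_eq_left_of_natDegree_lt (by rw [h2]; exact lt_of_le_of_lt h1 hp.one_lt), h2]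
  have hmap : H.map e2 = 0 := by
    rcases comp_eq_zero_iff.1 hcomp with h1 | h1
    · exact h1
    · rw [h1.2, natDegree_C] at hQ
      exact absurd hQ.symm hp.ne_zero
  have hdvd : C (X ^ p - C (coeffPow p ρ)) ∣ H := by
    rw [C_dvd_iff_dvd_coeff]
    intro i
    refine X_pow_sub_dvd_of_eval₂_expand_eq_zero p hρ _ ?_
    have := congrArg (fun P => coeff P i) hmap
    rw [coeff_map, coeff_zero] at this
    exact this
  have := map_dvd Θ hdvd
  simpa [Θ, eval₂_pow] using this

/-! ### The divisor `d` and the decomposition `θ = θ*(X^p) + dρ` -/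

/-- Divisors of a nonzero constant are constants, and a constant divides `θ'(y)` exactly when it
divides the content of `θ'`; so the gcd of `a` with that content serves. -/
theorem exists_isGcd {R : Type*} [CommRing R] [IsDomain R] [UniqueFactorizationMonoid R]
    {a : R} (ha : a ≠ 0) (θ : R[X]) : ∃ d : R, IsGcd a θ d := by
  let _ : StrongNormalizationMonoid R := UniqueFactorizationMonoid.strongNormalizationMonoid
  let _ := UniqueFactorizationMonoid.toNormalizedGCDMonoid R
  have hd : gcd a (derivative θ).content ≠ 0 := fun h => ha ((gcd_eq_zero_iff _ _).1 h).1
  refine ⟨gcd a (derivative θ).content, fun e => ?_⟩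
  have key : ∀ c : R, (MvPolynomial.C c : Poly2 R) ∣ aeval (y R) (derivative θ) ↔
      c ∣ (derivative θ).content := by
    intro c
    rw [dvd_content_iff_C_dvd]
    constructor
    · intro h
      let Φ : Poly2 R →ₐ[R] R[X] := MvPolynomial.aeval ![0, X]
      have h1 := map_dvd Φ h
      rw [← aeval_algHom_apply] at h1
      simpa [Φ, y, Polynomial.algebraMap_eq] using h1
    · intro h
      have h1 := map_dvd (aeval (y R)) h
      simpa [MvPolynomial.algebraMap_eq] using h1
  have hC : ∀ {c c' : R}, (MvPolynomial.C c : Poly2 R) ∣ MvPolynomial.C c' ↔ c ∣ c' := by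
    intro c c'
    constructor
    · intro h
      simpa using map_dvd MvPolynomial.constantCoeff h
    · exact map_dvd _
  constructor
  · intro h
    obtain ⟨c, hc, rfl⟩ := (MvPolynomial.dvd_C_iff_exists hd).1 h
    rw [hC, key]
    exact ⟨hc.trans (gcd_dvd_left _ _), hc.trans (gcd_dvd_right _ _)⟩
  · rintro ⟨h1, h2⟩
    obtain ⟨c, hc, rfl⟩ := (MvPolynomial.dvd_C_iff_exists ha).1 h1
    rw [key] at h2
    exact hC.2 (dvd_gcd hc h2)

theorem coeff_thetaStar {R : Type*} [CommRing R] {p : ℕ} (hp : 0 < p) {θ : R[X]}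
    (hθ₀ : θ.coeff 0 = 0) (n : ℕ) : (thetaStar p θ).coeff n = θ.coeff (p * n) := by
  simp only [thetaStar, finsetSum_coeff, coeff_C_mul, coeff_X_pow, mul_ite, mul_one, mul_zero]
  rw [Finset.sum_ite_eq]
  split_ifs with h
  · rfl
  · rw [Finset.mem_Icc, not_and_or] at h
    rcases h with h | h
    -- The sum defining `θ*` starts at `i = 1`; the missing constant term is that of `θ`, which is
    -- zero.
    · rw [show n = 0 by omega, mul_zero, hθ₀]
    · rw [coeff_eq_zero_of_natDegree_lt]
      nlinarith

theorem IsRho.eq_expand_add {R : Type*} [CommRing R] {p : ℕ} (hp : 0 < p) {θ ρ : R[X]} {d : R}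
    (hθ₀ : θ.coeff 0 = 0) (h : IsRho p θ d ρ) :
    θ = expand R p (thetaStar p θ) + C d * ρ := by
  ext n
  rw [coeff_add, coeff_C_mul, coeff_expand hp]
  split_ifs with hn
  · rw [coeff_thetaStar hp hθ₀, Nat.mul_div_cancel' hn, h.2 n hn, mul_zero, add_zero]
  · rw [h.1 n hn, zero_add]

theorem isUnit_natCast {R : Type*} [CommRing R] {p : ℕ} [Fact p.Prime] [CharP R p] {n : ℕ}
    (hn : ¬ p ∣ n) : IsUnit (n : R) := by
  have h : ((n : ZMod p)) ≠ 0 := by rwa [Ne, CharP.cast_eq_zero_iff (ZMod p) p]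
  have := h.isUnit.map (ZMod.castHom dvd_rfl R)
  simpa using this

theorem exists_isRho {R : Type*} [CommRing R] (p : ℕ) [Fact p.Prime] [CharP R p] {θ : R[X]} {d : R}
    (h : C d ∣ derivative θ) : ∃ ρ, IsRho p θ d ρ := by
  have hdvd : ∀ i, ¬ p ∣ i → d ∣ θ.coeff i := by
    intro i hi
    cases i with
    | zero => exact absurd (dvd_zero p) hi
    | succ i =>
      have := (C_dvd_iff_dvd_coeff _ _).1 h i
      rw [coeff_derivative, ← Nat.cast_succ] at this
      exact ((isUnit_natCast (R := R) hi).dvd_mul_right).1 this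
  choose t ht using hdvd
  classical
  refine ⟨∑ i ∈ Finset.range (θ.natDegree + 1), C (if hi : p ∣ i then 0 else t i hi) * X ^ i,
    fun i hi => ?_, fun i hi => ?_⟩
  · simp only [finsetSum_coeff, coeff_C_mul, coeff_X_pow, mul_ite, mul_one, mul_zero]
    rw [Finset.sum_ite_eq]
    split_ifs with h1
    · exact (ht i hi).symm
    · rw [mul_zero, coeff_eq_zero_of_natDegree_lt (by simpa using h1)]
  · simp only [finsetSum_coeff, coeff_C_mul, coeff_X_pow, mul_ite, mul_one, mul_zero]
    rw [Finset.sum_ite_eq]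
    simp [hi]

theorem IsRho.derivative_eq {R : Type*} [CommRing R] {p : ℕ} [CharP R p] (hp : 0 < p)
    {θ ρ : R[X]} {d : R} (hθ₀ : θ.coeff 0 = 0) (h : IsRho p θ d ρ) :
    derivative θ = C d * derivative ρ := by
  conv_lhs => rw [h.eq_expand_add hp hθ₀]
  rw [derivative_add, derivative_expand, CharP.cast_eq_zero, zero_mul, mul_zero, zero_add,
    derivative_C_mul]

/-- Otherwise `ϖ d` would divide both `a = bd` and `θ' = dρ'`, hence `d`, making `ϖ` a unit. This is
where maximality of `d` is used. -/
theorem IsGcd.map_derivative_ne_zero {R : Type*} [CommRing R] [IsDomain R] {p : ℕ} [CharP R p]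
    (hp : 0 < p) {a b d ϖ : R} (ha : a ≠ 0) {θ ρ : R[X]} (hθ₀ : θ.coeff 0 = 0) (hab : a = b * d)
    (hd : IsGcd a θ d) (h : IsRho p θ d ρ) (hϖ : Prime ϖ) (hb : ϖ ∣ b) :
    derivative (ρ.map (Ideal.Quotient.mk (Ideal.span {ϖ}))) ≠ 0 := by
  intro h0
  have hdne : d ≠ 0 := by rintro rfl; exact ha (by simp [hab])
  rw [derivative_map] at h0
  have h1 : C ϖ ∣ derivative ρ := by
    rw [C_dvd_iff_dvd_coeff]
    intro i
    have := congrArg (fun P => coeff P i) h0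
    rwa [coeff_map, coeff_zero, Ideal.Quotient.eq_zero_iff_mem, Ideal.mem_span_singleton] at this
  have h2 : (MvPolynomial.C (ϖ * d) : Poly2 R) ∣ MvPolynomial.C d := by
    rw [hd]
    refine ⟨map_dvd _ (hab ▸ mul_dvd_mul_right hb d), ?_⟩
    rw [h.derivative_eq hp hθ₀, map_mul (aeval (y R)), aeval_C, mul_comm ϖ, MvPolynomial.C_mul]
    have := map_dvd (aeval (y R)) h1
    rw [aeval_C] at this
    exact mul_dvd_mul_left _ this
  have h3 := map_dvd MvPolynomial.constantCoeff h2
  simp only [MvPolynomial.constantCoeff_C] at h3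
  obtain ⟨c, hc⟩ := h3
  refine hϖ.not_isUnit (IsUnit.of_mul_eq_one c (mul_left_cancel₀ hdne ?_))
  linear_combination -hc

/-! ### Integrality: explicit forms of `q₁`, `q₁'` and `q₂` -/

theorem f_eq {R : Type*} [CommRing R] {p : ℕ} (a : R) {θ ρ : R[X]} {d : R}
    (h : θ = expand R p (thetaStar p θ) + C d * ρ) :
    f a θ = MvPolynomial.C a * x R + aeval (y R ^ p) (thetaStar p θ)
      + MvPolynomial.C d * aeval (y R) ρ := by
  rw [f]
  conv_lhs => rw [h]
  rw [map_add, expand_aeval, map_mul, aeval_C, MvPolynomial.algebraMap_eq, add_assoc]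

theorem y_mem {R : Type*} [CommRing R] (a : R) (θ : R[X]) :
    y R ∈ Algebra.adjoin R {f a θ, y R} := Algebra.subset_adjoin (by simp)

theorem mem_of_mem_adjoin_f {R : Type*} [CommRing R] {a : R} {θ : R[X]} {F : Poly2 R}
    (hF : F ∈ Algebra.adjoin R {f a θ}) : F ∈ Algebra.adjoin R {f a θ, y R} :=
  Algebra.adjoin_mono (by simp) hF

theorem C_mem {R : Type*} [CommRing R] (A : Subalgebra R (Poly2 R)) (c : R) :
    MvPolynomial.C c ∈ A := A.algebraMap_mem c

theorem aeval_mem' {R T : Type*} [CommRing R] [CommRing T] [Algebra R T] (A : Subalgebra R T)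
    {s : T} (hs : s ∈ A) (P : R[X]) : aeval s P ∈ A :=
  Algebra.adjoin_le (S := A) (by simpa using hs) (aeval_mem_adjoin_singleton R s)

theorem q_mem {R : Type*} [CommRing R] {p : ℕ} {a : R} {θ : R[X]} {F : Poly2 R}
    (hF : F ∈ Algebra.adjoin R {f a θ}) : q p a F ∈ Algebra.adjoin R {f a θ, y R} :=
  sub_mem (pow_mem (y_mem a θ) _)
    (mul_mem (pow_mem (mul_mem (C_mem _ _) (mem_of_mem_adjoin_f hF)) _) (y_mem a θ))

/-- Since `y^p = q + aW` with `W = a^(p-2) F^(p-1) y`, Taylor expansion makes `θ*(y^p) - θ*(q)` a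
multiple of `a = bd`, so it can be absorbed into the term `ax`. -/
theorem exists_C_mul_eq_f_sub {R : Type*} [CommRing R] {p : ℕ} (hp : 2 ≤ p) {a b d : R}
    {θ ρ : R[X]} {F : Poly2 R} (hF : F ∈ Algebra.adjoin R {f a θ}) (hab : a = b * d)
    (h : θ = expand R p (thetaStar p θ) + C d * ρ) :
    ∃ w ∈ Algebra.adjoin R {f a θ, y R},
      MvPolynomial.C d * (aeval (y R) ρ + MvPolynomial.C b * (x R + w))
        = f a θ - aeval (q p a F) (thetaStar p θ) := by
  obtain ⟨m, rfl⟩ : ∃ m, p = m + 2 := ⟨p - 2, by omega⟩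
  have hFm := mem_of_mem_adjoin_f hF
  have hy := y_mem a θ
  set W : Poly2 R := MvPolynomial.C a ^ m * F ^ (m + 1) * y R with hW
  have hWm : W ∈ Algebra.adjoin R {f a θ, y R} :=
    mul_mem (mul_mem (pow_mem (C_mem _ _) _) (pow_mem hFm _)) hy
  obtain ⟨k, hk, e⟩ := exists_aeval_add_eq _ (thetaStar (m + 2) θ) (q_mem (p := m + 2) hF)
    (mul_mem (C_mem _ a) hWm)
  have hq : q (m + 2) a F + MvPolynomial.C a * W = y R ^ (m + 2) := by
    rw [q, hW, show m + 2 - 1 = m + 1 by omega]; ring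
  rw [hq] at e
  refine ⟨(aeval (q (m + 2) a F) (derivative (thetaStar (m + 2) θ))
    + k * (MvPolynomial.C a * W)) * W, ?_, ?_⟩
  · exact mul_mem (add_mem (aeval_mem' _ (q_mem hF) _) (mul_mem hk (mul_mem (C_mem _ a) hWm))) hWm
  · rw [f_eq a h, e, hab, MvPolynomial.C_mul]
    ring

theorem expand_derivative_coeffPow {S : Type*} [CommRing S] (p : ℕ) [Fact p.Prime] [CharP S p]
    (ρ : S[X]) : expand S p (derivative (coeffPow p ρ)) = derivative ρ ^ p := by
  rw [coeffPow_eq_map_frobenius, derivative_map, ← map_expand, map_frobenius_expand]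

/-- Expand `ρ^p` at `q = y^p - b^(p-1) V`, with `V = (dF)^(p-1) y`. The constant term `ρ(y)^p`
cancels by Frobenius, the linear term contributes `ρ'(y)^p V`, and the quadratic one has a spare
factor `b` beyond `b^(p-1)`. -/
theorem exists_C_mul_eq_pow_sub {R : Type*} [CommRing R] {p : ℕ} [Fact p.Prime] [CharP R p]
    {a b d : R} {θ ρ : R[X]} {F z : Poly2 R} (hF : F ∈ Algebra.adjoin R {f a θ})
    (hab : a = b * d) :
    ∃ k ∈ Algebra.adjoin R {f a θ, y R},
      MvPolynomial.C (b ^ (p - 1)) * (MvPolynomial.C b * z ^ p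
          + aeval (y R) (derivative ρ) ^ p * ((MvPolynomial.C d * F) ^ (p - 1) * y R)
          + MvPolynomial.C b * k)
        = (aeval (y R) ρ + MvPolynomial.C b * z) ^ p - aeval (q p a F) (coeffPow p ρ) := by
  obtain ⟨m, hm⟩ : ∃ m, p = m + 2 := ⟨p - 2, by have := (Fact.out : p.Prime).two_le; omega⟩
  have hFm := mem_of_mem_adjoin_f hF
  have hy := y_mem a θ
  set V : Poly2 R := (MvPolynomial.C d * F) ^ (p - 1) * y R with hV
  have hVm : V ∈ Algebra.adjoin R {f a θ, y R} :=
    mul_mem (pow_mem (mul_mem (C_mem _ _) hFm) _) hy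
  obtain ⟨k, hk, e⟩ := exists_aeval_add_eq _ (coeffPow p ρ) (pow_mem hy p)
    (neg_mem (mul_mem (C_mem _ (b ^ (p - 1))) hVm))
  have hq : y R ^ p + -(MvPolynomial.C (b ^ (p - 1)) * V) = q p a F := by
    rw [q, hV, hab, MvPolynomial.C_mul, MvPolynomial.C_pow]; ring
  rw [hq, ← expand_aeval, ← expand_aeval, expand_coeffPow, expand_derivative_coeffPow] at e
  refine ⟨-(k * MvPolynomial.C (b ^ m) * V ^ 2), neg_mem (mul_mem (mul_mem hk (C_mem _ _))
    (pow_mem hVm _)), ?_⟩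
  rw [e, add_pow_char, map_pow (aeval (y R)), map_pow (aeval (y R))]
  have hb : ∀ T : Poly2 R, MvPolynomial.C b ^ p * T = MvPolynomial.C (b ^ (p - 1)) * (MvPolynomial.C b * T) := by
    intro T
    rw [hm, show m + 2 - 1 = m + 1 by omega, MvPolynomial.C_pow]; ring
  have hb' : (MvPolynomial.C (b ^ (p - 1)) : Poly2 R) = MvPolynomial.C (b ^ m) * MvPolynomial.C b := by
    rw [hm, show m + 2 - 1 = m + 1 by omega, pow_succ, MvPolynomial.C_mul]
  rw [mul_pow (MvPolynomial.C b) z, hb]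
  conv_rhs => rw [show (-(MvPolynomial.C (b ^ (p - 1)) * V)) ^ 2
    = MvPolynomial.C (b ^ (p - 1)) * (MvPolynomial.C (b ^ m) * MvPolynomial.C b) * V ^ 2 by
      rw [← hb']; ring]
  ring

/-- The only term of `q₁'` not visibly divisible by `b` is `ρ'(y)^p y (dF)^(p-1)`, which is `λ(y^p,
ρ(y)) (dF)^(p-1)`. As `q` and `q₁` agree with `y^p` and `ρ(y)` modulo `b`, subtraction cancels it.
The first-order terms give `α` and `β`; `m` needs no control because it carries a factor `b`. -/
theorem exists_C_mul_eq_sub_aeval_mul {R : Type*} [CommRing R] {p : ℕ} (hp : 2 ≤ p)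
    {a b d : R} {θ ρ : R[X]} {F z k : Poly2 R} (hF : F ∈ Algebra.adjoin R {f a θ})
    (hab : a = b * d) (hk : k ∈ Algebra.adjoin R {f a θ, y R}) (lam : MvPolynomial (Fin 2) R)
    (hlam : derivative ρ ^ p * X = MvPolynomial.aeval ![X ^ p, ρ] lam) :
    ∃ α ∈ Algebra.adjoin R {f a θ, y R}, ∃ β ∈ Algebra.adjoin R {f a θ, y R}, ∃ m : Poly2 R,
      MvPolynomial.C b * (z ^ p + α * z + β + MvPolynomial.C b * m)
        = MvPolynomial.C b * z ^ p
          + aeval (y R) (derivative ρ) ^ p * ((MvPolynomial.C d * F) ^ (p - 1) * y R)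
          + MvPolynomial.C b * k
          - MvPolynomial.aeval ![q p a F, aeval (y R) ρ + MvPolynomial.C b * z] lam
            * (MvPolynomial.C d * F) ^ (p - 1) := by
  obtain ⟨n, rfl⟩ : ∃ m, p = m + 2 := ⟨p - 2, by omega⟩
  have hFm := mem_of_mem_adjoin_f hF
  have hy := y_mem a θ
  set A := Algebra.adjoin R {f a θ, y R}
  set G : Poly2 R := (MvPolynomial.C d * F) ^ (n + 2 - 1) with hG
  have hGm : G ∈ A := pow_mem (mul_mem (C_mem _ _) hFm) _
  obtain ⟨m, hm⟩ := exists_aeval_add_mul_eq (R := R) (y R ^ (n + 2)) (aeval (y R) ρ)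
    (-(MvPolynomial.C b ^ n * (G * y R))) z (MvPolynomial.C b) lam
  have hq : y R ^ (n + 2) + MvPolynomial.C b * -(MvPolynomial.C b ^ n * (G * y R))
      = q (n + 2) a F := by
    rw [q, hG, hab, MvPolynomial.C_mul, show n + 2 - 1 = n + 1 by omega]; ring
  have hmem : ∀ P : MvPolynomial (Fin 2) R, MvPolynomial.aeval ![y R ^ (n + 2), aeval (y R) ρ] P ∈ A := by
    intro P
    induction P using MvPolynomial.induction_on with
    | C c => rw [MvPolynomial.aeval_C]; exact A.algebraMap_mem c
    | add P Q hP hQ => rw [map_add]; exact add_mem hP hQ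
    | mul_X P i hP =>
      rw [map_mul, MvPolynomial.aeval_X]
      refine mul_mem hP ?_
      fin_cases i
      · exact pow_mem hy _
      · exact aeval_mem' A hy ρ
  have h0 : MvPolynomial.aeval ![y R ^ (n + 2), aeval (y R) ρ] lam
      = aeval (y R) (derivative ρ) ^ (n + 2) * y R := by
    have h1 := congrArg (aeval (y R)) hlam
    rw [map_mul, map_pow, aeval_X, ← AlgHom.comp_apply, MvPolynomial.comp_aeval] at h1
    rw [h1]
    congr 2
    ext i
    fin_cases i <;> simp
  rw [hq, h0] at hm
  refine ⟨_, neg_mem (mul_mem hGm (hmem (MvPolynomial.pderiv 1 lam))),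
    k + G * (MvPolynomial.C b ^ n * (G * y R)
      * MvPolynomial.aeval ![y R ^ (n + 2), aeval (y R) ρ] (MvPolynomial.pderiv 0 lam)),
    add_mem hk (mul_mem hGm (mul_mem (mul_mem (pow_mem (C_mem _ _) _) (mul_mem hGm hy))
      (hmem _))), -(m * G), ?_⟩
  rw [hm]
  ring

/-! ### Algebraic independence of `q` and `q₁`, over `R` and after reduction -/

theorem isAlgebraic_C {S : Type*} [CommRing S] [IsDomain S] (A : Subalgebra S (Poly2 S)) (c : S) :
    IsAlgebraic A (MvPolynomial.C c : Poly2 S) :=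
  isAlgebraic_algebraMap (algebraMap S A c)

theorem isAlgebraic_aeval {S : Type*} [CommRing S] [IsDomain S] (A : Subalgebra S (Poly2 S))
    {u : Poly2 S} (hu : IsAlgebraic A u) (P : S[X]) : IsAlgebraic A (aeval u P) := by
  induction P using Polynomial.induction_on' with
  | add P Q hP hQ => rw [map_add]; exact hP.add hQ
  | monomial n c =>
    rw [aeval_monomial]
    exact (isAlgebraic_C A c).mul (hu.pow n)

theorem injective_aeval_of_isAlgebraic_y {S : Type*} [CommRing S] [IsDomain S] {u v g : Poly2 S}
    {b : S} (hb : b ≠ 0)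
    (hy : IsAlgebraic (Algebra.adjoin S (Set.range ![u, v])) (y S))
    (hg : IsAlgebraic (Algebra.adjoin S (Set.range ![u, v])) g)
    (hx : MvPolynomial.C b * x S + g ∈ Algebra.adjoin S (Set.range ![u, v])) :
    Function.Injective (MvPolynomial.aeval ![u, v] : MvPolynomial (Fin 2) S →ₐ[S] Poly2 S) := by
  refine injective_aeval_of_isAlgebraic u v ?_ hy
  refine IsAlgebraic.of_mul (y := MvPolynomial.C b)
    (mem_nonZeroDivisors_of_ne_zero (by simpa using hb)) (isAlgebraic_C _ b) ?_
  have h1 : IsAlgebraic (Algebra.adjoin S (Set.range ![u, v])) (MvPolynomial.C b * x S + g) :=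
    isAlgebraic_algebraMap (⟨_, hx⟩ : Algebra.adjoin S (Set.range ![u, v]))
  simpa using h1.sub hg

theorem left_mem_adjoin_range {S T : Type*} [CommRing S] [CommRing T] [Algebra S T] (u v : T) :
    u ∈ Algebra.adjoin S (Set.range ![u, v]) := Algebra.subset_adjoin ⟨0, rfl⟩

theorem right_mem_adjoin_range {S T : Type*} [CommRing S] [CommRing T] [Algebra S T] (u v : T) :
    v ∈ Algebra.adjoin S (Set.range ![u, v]) := Algebra.subset_adjoin ⟨1, rfl⟩

theorem injective_aeval_y_pow {S : Type*} [CommRing S] [IsDomain S] {p : ℕ} (hp : 0 < p) {b : S}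
    (hb : b ≠ 0) (ρ w : S[X]) :
    Function.Injective (MvPolynomial.aeval ![y S ^ p,
        aeval (y S) ρ + MvPolynomial.C b * (x S + aeval (y S) w)] :
      MvPolynomial (Fin 2) S →ₐ[S] Poly2 S) := by
  set v := aeval (y S) ρ + MvPolynomial.C b * (x S + aeval (y S) w) with hv
  have hy : IsAlgebraic (Algebra.adjoin S (Set.range ![y S ^ p, v])) (y S) :=
    IsAlgebraic.of_pow hp (isAlgebraic_algebraMap
      (⟨_, left_mem_adjoin_range _ _⟩ : Algebra.adjoin S (Set.range ![y S ^ p, v])))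
  refine injective_aeval_of_isAlgebraic_y hb (g := aeval (y S) (ρ + C b * w)) hy
    (isAlgebraic_aeval _ hy _) ?_
  convert right_mem_adjoin_range (S := S) (y S ^ p) v using 1
  rw [hv, map_add, map_mul, aeval_C, MvPolynomial.algebraMap_eq]
  ring

theorem f_mem_of_C_mul_eq {R : Type*} [CommRing R] {p : ℕ} {a d : R} {θ : R[X]} {F q₁ : Poly2 R}
    (hq₁ : MvPolynomial.C d * q₁ = f a θ - aeval (q p a F) (thetaStar p θ))
    (A : Subalgebra R (Poly2 R)) (h0 : q p a F ∈ A) (h1 : q₁ ∈ A) : f a θ ∈ A := by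
  rw [eq_add_of_sub_eq hq₁.symm]
  exact add_mem (mul_mem (C_mem A d) h1) (aeval_mem' A h0 _)

theorem F_mem_of_f_mem {R : Type*} [CommRing R] {a : R} {θ : R[X]} {F : Poly2 R}
    (hF : F ∈ Algebra.adjoin R {f a θ}) (A : Subalgebra R (Poly2 R)) (h : f a θ ∈ A) : F ∈ A :=
  Algebra.adjoin_le (S := A) (by simpa using h) hF

theorem injective_aeval_q {R : Type*} [CommRing R] [IsDomain R] {p : ℕ} (hp : 2 ≤ p) {a d : R}
    (ha : a ≠ 0) {θ : R[X]} {F q₁ : Poly2 R} (hF : F ∈ Algebra.adjoin R {f a θ})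
    (hq₁ : MvPolynomial.C d * q₁ = f a θ - aeval (q p a F) (thetaStar p θ)) :
    Function.Injective (MvPolynomial.aeval ![q p a F, q₁] :
      MvPolynomial (Fin 2) R →ₐ[R] Poly2 R) := by
  set A := Algebra.adjoin R (Set.range ![q p a F, q₁])
  have h0 : q p a F ∈ A := left_mem_adjoin_range _ _
  have h1 : q₁ ∈ A := right_mem_adjoin_range _ _
  have hf : f a θ ∈ A := f_mem_of_C_mul_eq hq₁ A h0 h1
  have hFA : F ∈ A := F_mem_of_f_mem hF A hf
  have hy : IsAlgebraic A (y R) := by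
    have hc : (MvPolynomial.C a * F) ^ (p - 1) ∈ A := pow_mem (mul_mem (C_mem A a) hFA) _
    -- The definition of `q` is itself a monic equation for `y`, whose coefficients lie in `A`
    -- because `F` does.
    refine IsIntegral.isAlgebraic ⟨X ^ p - (C (⟨_, hc⟩ : A) * X + C ⟨_, h0⟩), ?_, ?_⟩
    · refine monic_X_pow_sub ?_
      refine lt_of_le_of_lt (degree_linear_le) ?_
      exact_mod_cast (by omega : 1 < p)
    · simp [q]
  exact injective_aeval_of_isAlgebraic_y ha hy (isAlgebraic_aeval _ hy θ) hf

/-! ### Reduction modulo a prime factor of `a` -/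

theorem map_Lambda {S T : Type*} [CommRing S] [CommRing T] (p : ℕ) [Fact p.Prime] [CharP S p]
    [CharP T p] (g : S →+* T) (b : S) (ρ : S[X]) (lam nu : MvPolynomial (Fin 2) S) :
    MvPolynomial.map g (Lambda p b ρ lam nu)
      = Lambda p (g b) (ρ.map g) (MvPolynomial.map g lam) (MvPolynomial.map g nu) := by
  have h1 : (coeffPow p ρ).map g = coeffPow p (ρ.map g) := by
    rw [coeffPow_eq_map_frobenius, coeffPow_eq_map_frobenius, Polynomial.map_map,
      Polynomial.map_map, RingHom.frobenius_comm]
  have h2 : (fun i => MvPolynomial.map g (![(MvPolynomial.X 0 : Poly3 S), MvPolynomial.X 1] i))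
      = ![MvPolynomial.X 0, MvPolynomial.X 1] := by
    ext i : 1
    fin_cases i <;> simp
  simp only [Lambda, map_add, map_sub, map_mul, map_pow, map_aeval_eq, map_mvAeval_eq, h1, h2,
    MvPolynomial.map_X, MvPolynomial.map_C]

theorem charP_quotient_span {R : Type*} [CommRing R] (p : ℕ) [Fact p.Prime] [CharP R p] {ϖ : R}
    (hϖ : Prime ϖ) : CharP (R ⧸ Ideal.span {ϖ}) p := by
  have : (Ideal.span {ϖ}).IsPrime := (Ideal.span_singleton_prime hϖ.ne_zero).2 hϖ
  obtain ⟨c, hc⟩ := CharP.exists (R ⧸ Ideal.span {ϖ})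
  have h1 : c ∣ p := by
    rw [← CharP.cast_eq_zero_iff (R ⧸ Ideal.span {ϖ}) c, ← map_natCast (Ideal.Quotient.mk _),
      CharP.cast_eq_zero, map_zero]
  rcases (Nat.dvd_prime Fact.out).1 h1 with rfl | rfl
  · exact absurd rfl (CharP.char_ne_one (R ⧸ Ideal.span {ϖ}) 1)
  · exact hc

/-- Modulo `ϖ` the term `ax` of `f` disappears and `f` becomes a polynomial in `y`. -/
theorem exists_map_eq_aeval_y {R : Type*} [CommRing R] {a ϖ : R} (ha : ϖ ∣ a) {θ : R[X]}
    {g : Poly2 R} (hg : g ∈ Algebra.adjoin R {f a θ, y R}) :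
    ∃ e : (R ⧸ Ideal.span {ϖ})[X],
      MvPolynomial.map (Ideal.Quotient.mk (Ideal.span {ϖ})) g = aeval (y _) e := by
  have ha0 : Ideal.Quotient.mk (Ideal.span {ϖ}) a = 0 := by
    rwa [Ideal.Quotient.eq_zero_iff_mem, Ideal.mem_span_singleton]
  have hy : MvPolynomial.map (Ideal.Quotient.mk (Ideal.span {ϖ})) (y R) = y _ := by simp [y]
  induction hg using Algebra.adjoin_induction with
  | mem g hg =>
    rcases hg with rfl | rfl
    · refine ⟨θ.map (Ideal.Quotient.mk _), ?_⟩
      rw [f, map_add, map_mul, MvPolynomial.map_C, ha0, map_zero, zero_mul, zero_add,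
        map_aeval_eq, hy]
    · exact ⟨X, by rw [hy, aeval_X]⟩
  | algebraMap r =>
    exact ⟨C (Ideal.Quotient.mk _ r), by simp [MvPolynomial.algebraMap_eq]⟩
  | add g h _ _ hg hh =>
    obtain ⟨e, he⟩ := hg
    obtain ⟨e', he'⟩ := hh
    exact ⟨e + e', by rw [map_add, map_add, he, he']⟩
  | mul g h _ _ hg hh =>
    obtain ⟨e, he⟩ := hg
    obtain ⟨e', he'⟩ := hh
    exact ⟨e * e', by rw [map_mul, map_mul, he, he']⟩

theorem exists_aeval_eq_C_mul {R : Type*} [CommRing R] [IsDomain R] {p : ℕ} [Fact p.Prime]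
    [CharP R p] {a b ϖ : R} {θ ρ : R[X]} {F w α β m q₂ : Poly2 R} (hϖ : Prime ϖ) (ha : ϖ ∣ a)
    (hρ : ϖ ∣ b → derivative (ρ.map (Ideal.Quotient.mk (Ideal.span {ϖ}))) ≠ 0)
    (hw : w ∈ Algebra.adjoin R {f a θ, y R}) (hα : α ∈ Algebra.adjoin R {f a θ, y R})
    (hβ : β ∈ Algebra.adjoin R {f a θ, y R})
    (hq₂ : q₂ = (x R + w) ^ p + α * (x R + w) + β + MvPolynomial.C b * m)
    (lam nu : MvPolynomial (Fin 2) R)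
    (hΛ : MvPolynomial.aeval ![q p a F, aeval (y R) ρ + MvPolynomial.C b * (x R + w), q₂]
      (Lambda p b ρ lam nu) = 0) {h : Poly3 R}
    (hh : MvPolynomial.C ϖ ∣
      MvPolynomial.aeval ![q p a F, aeval (y R) ρ + MvPolynomial.C b * (x R + w), q₂] h) :
    ∃ h' : Poly3 R, MvPolynomial.aeval ![q p a F, aeval (y R) ρ + MvPolynomial.C b * (x R + w), q₂] h
      = MvPolynomial.C ϖ *
        MvPolynomial.aeval ![q p a F, aeval (y R) ρ + MvPolynomial.C b * (x R + w), q₂] h' := by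
  have hp : p.Prime := Fact.out
  have h2 := hp.two_le
  set q₁ : Poly2 R := aeval (y R) ρ + MvPolynomial.C b * (x R + w) with hq₁
  have : (Ideal.span {ϖ}).IsPrime := (Ideal.span_singleton_prime hϖ.ne_zero).2 hϖ
  have := charP_quotient_span p hϖ
  set g := Ideal.Quotient.mk (Ideal.span {ϖ}) with hg
  have hz : ∀ {c}, g c = 0 ↔ ϖ ∣ c := by
    intro c
    rw [hg, Ideal.Quotient.eq_zero_iff_mem, Ideal.mem_span_singleton]
  have hy : MvPolynomial.map g (y R) = y _ := by simp [y]
  have hx : MvPolynomial.map g (x R) = x _ := by simp [x]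
  obtain ⟨w', hw'⟩ := exists_map_eq_aeval_y ha hw
  obtain ⟨α', hα'⟩ := exists_map_eq_aeval_y ha hα
  obtain ⟨β', hβ'⟩ := exists_map_eq_aeval_y ha hβ
  have e0 : MvPolynomial.map g (q p a F) = y _ ^ p := by
    rw [q, map_sub, map_mul, map_pow, map_pow, map_mul, MvPolynomial.map_C, hz.2 ha, map_zero,
      zero_mul, zero_pow (by omega), zero_mul, sub_zero, hy]
  have e1 : MvPolynomial.map g q₁ = aeval (y _) (ρ.map g)
      + MvPolynomial.C (g b) * (x _ + aeval (y _) w') := by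
    rw [hq₁, map_add, map_mul, map_add, map_aeval_eq, hy, hx, hw', MvPolynomial.map_C]
  have emap : ∀ P : Poly3 R, MvPolynomial.map g (MvPolynomial.aeval ![q p a F, q₁, q₂] P)
      = MvPolynomial.aeval ![y _ ^ p, MvPolynomial.map g q₁, MvPolynomial.map g q₂]
        (MvPolynomial.map g P) := by
    intro P
    rw [map_mvAeval_eq]
    congr 2
    ext i : 1
    fin_cases i <;> simp [e0]
  -- The two cases: if `ϖ ∣ b`, `q₁` reduces to `ρ(y)` and `q₂` to a polynomial monic in `x`;
  -- otherwise `b` stays nonzero and the reductions of `q`, `q₁` are algebraically independent.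
  have hdvd : MvPolynomial.map g (Lambda p b ρ lam nu) ∣ MvPolynomial.map g h := by
    have hΛ' := congrArg (MvPolynomial.map g) hΛ
    rw [emap, map_zero] at hΛ'
    rw [← map_mk_eq_zero_iff, emap] at hh
    rw [map_Lambda] at hΛ' ⊢
    by_cases hb : ϖ ∣ b
    · have hb0 := hz.2 hb
      rw [e1, hb0, map_zero, zero_mul, add_zero] at hh
      rw [hq₂, map_add, map_add, map_add, map_mul, map_mul, map_pow, map_add, hx, hw', hα', hβ',
        MvPolynomial.map_C, hb0, map_zero, zero_mul, add_zero] at hh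
      have := X_pow_sub_dvd_of_aeval_eq_zero p (hρ hb) w' α' β' hh
      rw [hb0, Lambda, zero_pow hp.ne_zero, zero_pow (by omega), map_zero, zero_mul, zero_mul,
        zero_mul, add_zero, zero_add]
      rwa [← neg_dvd, neg_sub] at this
    · rw [e1] at hh hΛ'
      exact Lambda_dvd_of_aeval_eq_zero h2 (fun h0 => hb (hz.1 h0)) _ _ _
        (injective_aeval_y_pow hp.pos (fun h0 => hb (hz.1 h0)) _ _) hΛ' hh
  obtain ⟨k, hk⟩ := hdvd
  obtain ⟨k', rfl⟩ := MvPolynomial.map_surjective g Ideal.Quotient.mk_surjective k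
  have h3 : MvPolynomial.map g (h - Lambda p b ρ lam nu * k') = 0 := by
    rw [map_sub, map_mul, hk, sub_self]
  rw [map_mk_eq_zero_iff] at h3
  obtain ⟨h', hh'⟩ := h3
  refine ⟨h', ?_⟩
  rw [eq_add_of_sub_eq hh', map_add, map_mul, map_mul, hΛ, zero_mul, add_zero,
    MvPolynomial.aeval_C, MvPolynomial.algebraMap_eq]

/-! ### Invariants up to powers of `a` -/

theorem exists_C_pow_mul_mem_of_hom_eq {R : Type*} [CommRing R] [IsDomain R] {p : ℕ} [Fact p.Prime]
    [CharP R p] {a : R} (ha : a ≠ 0) {θ : R[X]} {F : Poly2 R} (hF : F ≠ 0)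
    (hFf : F ∈ Algebra.adjoin R {f a θ}) (A : Subalgebra R (Poly2 R)) (hf : f a θ ∈ A)
    (hq : q p a F ∈ A) {g : Poly2 R} (hg : hom a θ F g = g) :
    ∃ N : ℕ, MvPolynomial.C (a ^ N) * g ∈ A := by
  obtain ⟨F₀, rfl⟩ : ∃ F₀ : R[X], aeval (f a θ) F₀ = F := by
    rw [Algebra.adjoin_singleton_eq_range_aeval] at hFf
    exact hFf
  let Ψ : R[X][X] →+* Poly2 R := eval₂RingHom (aeval (f a θ) : R[X] →ₐ[R] Poly2 R).toRingHom (y R)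
  have hΨC : ∀ P : R[X], Ψ (C P) = aeval (f a θ) P := fun P => by simp [Ψ]
  have hΨX : Ψ X = y R := by simp [Ψ]
  have hinj : Function.Injective Ψ := by
    have h1 : Function.Injective (MvPolynomial.aeval ![f a θ, y R] :
        MvPolynomial (Fin 2) R →ₐ[R] Poly2 R) := by
      have hy : IsAlgebraic (Algebra.adjoin R (Set.range ![f a θ, y R])) (y R) :=
        isAlgebraic_algebraMap (⟨_, right_mem_adjoin_range _ _⟩ :
          Algebra.adjoin R (Set.range ![f a θ, y R]))
      exact injective_aeval_of_isAlgebraic_y ha hy (isAlgebraic_aeval _ hy θ)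
        (left_mem_adjoin_range _ _)
    let ι : R[X][X] →+* MvPolynomial (Fin 2) R := eval₂RingHom
      (aeval (MvPolynomial.X 0) : R[X] →ₐ[R] MvPolynomial (Fin 2) R).toRingHom (MvPolynomial.X 1)
    let κ : MvPolynomial (Fin 2) R →ₐ[R] R[X][X] := MvPolynomial.aeval ![C X, X]
    have hι : (κ : MvPolynomial (Fin 2) R →+* R[X][X]).comp ι = RingHom.id _ := by
      refine Polynomial.ringHom_ext' (Polynomial.ringHom_ext' ?_ ?_) ?_
      · ext r; simp [ι, κ]
      · simp [ι, κ]
      · simp [ι, κ]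
    have hΨ : Ψ = ((MvPolynomial.aeval ![f a θ, y R] :
        MvPolynomial (Fin 2) R →ₐ[R] Poly2 R) : MvPolynomial (Fin 2) R →+* Poly2 R).comp ι := by
      refine Polynomial.ringHom_ext' (Polynomial.ringHom_ext' ?_ ?_) ?_
      · ext r : 1; simp [Ψ, ι]
      · simp [Ψ, ι]
      · simp [Ψ, ι]
    rw [hΨ, RingHom.coe_comp]
    exact h1.comp (Function.LeftInverse.injective (g := κ) fun P => DFunLike.congr_fun hι P)
  have hex : ∀ g : Poly2 R, ∃ (N : ℕ) (G : R[X][X]), MvPolynomial.C (a ^ N) * g = Ψ G := by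
    intro g
    induction g using MvPolynomial.induction_on with
    | C c => exact ⟨0, C (C c), by rw [hΨC, aeval_C]; simp [MvPolynomial.algebraMap_eq]⟩
    | add P Q hP hQ =>
      obtain ⟨N, G, h⟩ := hP
      obtain ⟨N', G', h'⟩ := hQ
      refine ⟨N + N', C (C (a ^ N')) * G + C (C (a ^ N)) * G', ?_⟩
      rw [map_add, map_mul, map_mul, hΨC, hΨC, aeval_C, aeval_C, ← h, ← h', pow_add,
        MvPolynomial.C_mul, MvPolynomial.algebraMap_eq]
      ring
    | mul_X P i hP =>
      obtain ⟨N, G, h⟩ := hP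
      fin_cases i
      -- One more power of `a` suffices for `x`, since `ax = f - θ(y)`.
      · refine ⟨N + 1, G * (C X - θ.map C), ?_⟩
        have hθ : Ψ (θ.map C) = aeval (y R) θ := by
          rw [← Polynomial.coe_mapRingHom, ← RingHom.comp_apply]
          have : Ψ.comp (mapRingHom C) = (aeval (y R) : R[X] →ₐ[R] Poly2 R).toRingHom := by
            refine Polynomial.ringHom_ext' ?_ ?_
            · ext r : 1; simp [Ψ]
            · simp [Ψ]
          rw [this]; rfl
        rw [map_mul, map_sub, hΨC, aeval_X, hθ, ← h, f, add_sub_cancel_right, pow_succ,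
          MvPolynomial.C_mul, x]
        simp only [Fin.zero_eta]
        ring
      · refine ⟨N, G * X, ?_⟩
        rw [map_mul, hΨX, ← h, y, mul_assoc]
        rfl
  obtain ⟨N, G, hG⟩ := hex g
  refine ⟨N, ?_⟩
  have hF₀ : F₀ ≠ 0 := by rintro rfl; exact hF (map_zero _)
  -- Through the injection `Ψ`, φ becomes the translation of the outer variable by `a F₀`, so
  -- invariance of `g` passes to `G`.
  have hcomp : G.comp (X + C (C a * F₀)) = G := by
    apply hinj
    have h1 : (hom a θ (aeval (f a θ) F₀) : Poly2 R →+* Poly2 R).comp Ψ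
        = Ψ.comp (compRingHom (X + C (C a * F₀))) := by
      refine Polynomial.ringHom_ext' (Polynomial.ringHom_ext' ?_ ?_) ?_
      · ext r : 1; simp [Ψ]
      · simp [hΨC, hom_f]
      · simp [hΨC, hΨX, hom_y, MvPolynomial.algebraMap_eq]
    have h2 := DFunLike.congr_fun h1 G
    simp only [RingHom.comp_apply, RingHom.coe_coe, coe_compRingHom_apply] at h2
    rw [← h2, ← hG, map_mul (hom a θ (aeval (f a θ) F₀)), hg]
    congr 1
    exact (hom a θ (aeval (f a θ) F₀)).commutes (a ^ N)
  obtain ⟨H, hH⟩ := comp_eq_of_comp_X_add_C_eq p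
    (mul_ne_zero (C_ne_zero.2 ha) hF₀) G hcomp
  rw [hG, hH]
  have hQ : Ψ (X ^ p - C ((C a * F₀) ^ (p - 1)) * X) = q p a (aeval (f a θ) F₀) := by
    rw [map_sub, map_mul, map_pow, hΨX, hΨC, map_pow, map_mul, aeval_C, q,
      MvPolynomial.algebraMap_eq]
  clear hH
  induction H using Polynomial.induction_on' with
  | add P Q hP hQ => rw [add_comp, map_add]; exact add_mem hP hQ
  | monomial n c =>
    rw [monomial_comp, map_mul, map_pow, hQ, hΨC]
    exact mul_mem (aeval_mem' A hf c) (pow_mem hq n)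

/-! ### Invariance of the generators, and removal of the power of `a` -/

theorem mem_invariants_iff {R : Type*} [CommRing R] [IsDomain R] {a : R} {ha : a ≠ 0} {θ : R[X]}
    {F : Poly2 R} {hF : F ∈ Algebra.adjoin R {f a θ}} {g : Poly2 R} :
    g ∈ invariants (aut a ha θ F hF) ↔ hom a θ F g = g := Iff.rfl

theorem hom_C {R : Type*} [CommRing R] (a : R) (θ : R[X]) (F : Poly2 R) (c : R) :
    hom a θ F (MvPolynomial.C c) = MvPolynomial.C c := (hom a θ F).commutes c

theorem hom_q {R : Type*} [CommRing R] {p : ℕ} [Fact p.Prime] [CharP R p] {a : R} {θ : R[X]}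
    {F : Poly2 R} (hF : F ∈ Algebra.adjoin R {f a θ}) : hom a θ F (q p a F) = q p a F := by
  have e : (MvPolynomial.C a * F) ^ p = (MvPolynomial.C a * F) ^ (p - 1) * (MvPolynomial.C a * F) := by
    rw [← pow_succ, Nat.sub_add_cancel (Fact.out : p.Prime).pos]
  rw [q, map_sub, map_mul, map_pow, map_pow, map_mul, hom_C, hom_y, hom_of_mem a θ F hF,
    add_pow_char, e]
  ring

theorem hom_eq_of_C_mul {R : Type*} [CommRing R] [IsDomain R] {a c : R} {θ : R[X]} {F g : Poly2 R}
    (hc : c ≠ 0) (h : hom a θ F (MvPolynomial.C c * g) = MvPolynomial.C c * g) :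
    hom a θ F g = g := by
  rw [map_mul, hom_C] at h
  exact mul_left_cancel₀ (by simpa using hc) h

theorem hom_aeval {R : Type*} [CommRing R] {a : R} {θ : R[X]} {F s : Poly2 R}
    (hs : hom a θ F s = s) (P : R[X]) : hom a θ F (aeval s P) = aeval s P := by
  rw [← aeval_algHom_apply, hs]

theorem hom_mvAeval {R : Type*} [CommRing R] {a : R} {θ : R[X]} {F u v : Poly2 R}
    (hu : hom a θ F u = u) (hv : hom a θ F v = v) (P : MvPolynomial (Fin 2) R) :
    hom a θ F (MvPolynomial.aeval ![u, v] P) = MvPolynomial.aeval ![u, v] P := by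
  rw [← AlgHom.comp_apply]
  congr 1
  refine MvPolynomial.algHom_ext fun i => ?_
  fin_cases i <;> simp [hu, hv]

theorem range_vec3 {T : Type*} (u v w : T) : Set.range ![u, v, w] = {u, v, w} := by
  ext t
  simp [eq_comm]
  tauto

theorem mem_range_of_C_mul_mem_range {R : Type*} [CommRing R] [IsDomain R]
    [UniqueFactorizationMonoid R] (Φ : Poly3 R →ₐ[R] Poly2 R) {a : R} (ha : a ≠ 0)
    (hΦ : ∀ ϖ : R, Prime ϖ → ϖ ∣ a → ∀ h, MvPolynomial.C ϖ ∣ Φ h →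
      ∃ h', Φ h = MvPolynomial.C ϖ * Φ h') {N : ℕ} {c : R} (hc : c ∣ a ^ N) {g : Poly2 R}
    (hg : MvPolynomial.C c * g ∈ Φ.range) : g ∈ Φ.range := by
  induction c using UniqueFactorizationMonoid.induction_on_prime generalizing g with
  | h₁ => exact absurd (zero_dvd_iff.1 hc) (pow_ne_zero N ha)
  | h₂ c hu =>
    obtain ⟨e, he⟩ := hu.exists_left_inv
    have := mul_mem (C_mem Φ.range e) hg
    rwa [← mul_assoc, ← MvPolynomial.C_mul, he, MvPolynomial.C_1, one_mul] at this
  | h₃ c ϖ h0 hϖ ih =>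
    obtain ⟨h, hh⟩ := hg
    change Φ h = _ at hh
    rw [MvPolynomial.C_mul, mul_assoc] at hh
    obtain ⟨h', hh'⟩ := hΦ ϖ hϖ (hϖ.dvd_of_dvd_pow ((dvd_mul_right ϖ c).trans hc)) h
      (Dvd.intro _ hh.symm)
    refine ih ((dvd_mul_left c ϖ).trans hc) ⟨h', ?_⟩
    rw [hh] at hh'
    exact (mul_left_cancel₀ (by simpa using hϖ.ne_zero) hh').symm

end Nagata

open Nagata in
theorem mainTheorem9 {R : Type*} [CommRing R] [IsDomain R] [UniqueFactorizationMonoid R]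
    (p : ℕ) [CharP R p] (hp : 0 < p)
    (a : R) (ha : a ≠ 0)
    (θ : R[X]) (hθ : θ ≠ 0) (hθ₀ : θ.coeff 0 = 0)
    (F : Nagata.Poly2 R) (hF : F ≠ 0) (hFf : F ∈ Algebra.adjoin R {Nagata.f a θ}) :
    -- a greatest common divisor `d` of `a` and `θ'(y)` exists
    (∃ d : R, Nagata.IsGcd a θ d) ∧
    -- and for each choice of `d`, with the elements `b`, `ρ`, `q₁`, `q₁'` that it determines
    ∀ d : R, Nagata.IsGcd a θ d →
    ∃ (b : R) (ρ : R[X]) (q₁ q₁' : Nagata.Poly2 R),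
      a = b * d ∧
      Nagata.IsRho p θ d ρ ∧
      MvPolynomial.C d * q₁
        = Nagata.f a θ - aeval (Nagata.q p a F) (Nagata.thetaStar p θ) ∧
      MvPolynomial.C (b ^ (p - 1)) * q₁'
        = q₁ ^ p - aeval (Nagata.q p a F) (Nagata.coeffPow p ρ) ∧
      -- suitable `λ` and `ν` exist
      (∃ lam : MvPolynomial (Fin 2) R,
        derivative ρ ^ p * X = MvPolynomial.aeval ![X ^ p, ρ] lam) ∧
      (∃ nu : MvPolynomial (Fin 2) R,
        (MvPolynomial.C d * F) ^ (p - 1) = MvPolynomial.aeval ![Nagata.q p a F, q₁] nu) ∧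
      -- and for each choice of `λ` and `ν`, with the element `q₂` that it determines
      ∀ lam nu : MvPolynomial (Fin 2) R,
        derivative ρ ^ p * X = MvPolynomial.aeval ![X ^ p, ρ] lam →
        (MvPolynomial.C d * F) ^ (p - 1) = MvPolynomial.aeval ![Nagata.q p a F, q₁] nu →
        ∃ q₂ : Nagata.Poly2 R,
          MvPolynomial.C b * q₂
            = q₁' - MvPolynomial.aeval ![Nagata.q p a F, q₁] lam
                * (MvPolynomial.C d * F) ^ (p - 1) ∧
          ∃ (h₀ : Nagata.q p a F ∈ Nagata.invariants (Nagata.aut a ha θ F hFf))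
            (h₁ : q₁ ∈ Nagata.invariants (Nagata.aut a ha θ F hFf))
            (h₂ : q₂ ∈ Nagata.invariants (Nagata.aut a ha θ F hFf)),
            Nagata.invariants (Nagata.aut a ha θ F hFf)
              = Algebra.adjoin R {Nagata.q p a F, q₁, q₂} ∧
            RingHom.ker (MvPolynomial.aeval ![⟨Nagata.q p a F, h₀⟩, ⟨q₁, h₁⟩, ⟨q₂, h₂⟩] :
                Nagata.Poly3 R →ₐ[R] Nagata.invariants (Nagata.aut a ha θ F hFf))
              = Ideal.span {Nagata.Lambda p b ρ lam nu} ∧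
            Nonempty (Nagata.invariants (Nagata.aut a ha θ F hFf) ≃ₐ[R]
              Nagata.Poly3 R ⧸ Ideal.span {Nagata.Lambda p b ρ lam nu}) := by
  have hprime : p.Prime := (CharP.char_is_prime_or_zero R p).resolve_right hp.ne'
  have : Fact p.Prime := ⟨hprime⟩
  have hp2 := hprime.two_le
  refine ⟨exists_isGcd ha θ, fun d hd => ?_⟩
  obtain ⟨hda, hdθ⟩ := (hd (MvPolynomial.C d)).1 dvd_rfl
  have hda' : d ∣ a := by simpa using map_dvd MvPolynomial.constantCoeff hda
  have hdθ' : C d ∣ derivative θ := by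
    have h1 := map_dvd (MvPolynomial.aeval ![0, X] : Poly2 R →ₐ[R] R[X]) hdθ
    rw [← aeval_algHom_apply] at h1
    simpa [y, Polynomial.algebraMap_eq] using h1
  obtain ⟨b, hab'⟩ := hda'
  have hab : a = b * d := by rw [hab', mul_comm]
  have hb0 : b ≠ 0 := by rintro rfl; exact ha (by simp [hab])
  have hd0 : d ≠ 0 := by rintro rfl; exact ha (by simp [hab])
  obtain ⟨ρ, hρ⟩ := exists_isRho p hdθ'
  have hθe := hρ.eq_expand_add hp hθ₀
  obtain ⟨w, hw, hq₁⟩ := exists_C_mul_eq_f_sub hp2 hFf hab hθe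
  obtain ⟨k, hk, hq₁'⟩ := exists_C_mul_eq_pow_sub (ρ := ρ) (z := x R + w) hFf hab
  have hinj := injective_aeval_q hp2 ha hFf hq₁
  have iq : hom a θ F (q p a F) = q p a F := hom_q hFf
  have iq₁ : hom a θ F (aeval (y R) ρ + MvPolynomial.C b * (x R + w))
      = aeval (y R) ρ + MvPolynomial.C b * (x R + w) := by
    refine hom_eq_of_C_mul hd0 ?_
    rw [hq₁, map_sub, hom_f, hom_aeval iq]
  have iq₁' := hom_eq_of_C_mul (a := a) (θ := θ) (F := F) (pow_ne_zero (p - 1) hb0)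
    (by rw [hq₁', map_sub, map_pow, iq₁, hom_aeval iq])
  refine ⟨b, ρ, _, _, hab, hρ, hq₁, hq₁', ?_, ?_, ?_⟩
  · have h1 := derivative_pow_mul_mem p ρ (derivative ρ * X)
    rw [← mul_assoc, ← pow_succ, Nat.sub_add_cancel hp] at h1
    have h2 := Algebra.adjoin_mono (R := R) (t := Set.range ![X ^ p, ρ])
      (by rintro _ (rfl | rfl); exacts [⟨0, rfl⟩, ⟨1, rfl⟩]) h1
    rw [Algebra.adjoin_range_eq_range_aeval] at h2
    obtain ⟨lam, hlam⟩ := h2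
    exact ⟨lam, hlam.symm⟩
  · have h1 := f_mem_of_C_mul_eq hq₁ _ (left_mem_adjoin_range _ _) (right_mem_adjoin_range _ _)
    have h2 := pow_mem (mul_mem (C_mem _ d) (F_mem_of_f_mem hFf _ h1)) (p - 1)
    rw [Algebra.adjoin_range_eq_range_aeval] at h2
    obtain ⟨nu, hnu⟩ := h2
    exact ⟨nu, hnu.symm⟩
  intro lam nu hlam hnu
  obtain ⟨α, hα, β, hβ, m, hq₂⟩ := exists_C_mul_eq_sub_aeval_mul (z := x R + w) hp2 hFf hab hk
    lam hlam
  refine ⟨_, hq₂, ?_⟩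
  have iq₂ : hom a θ F ((x R + w) ^ p + α * (x R + w) + β + MvPolynomial.C b * m)
      = (x R + w) ^ p + α * (x R + w) + β + MvPolynomial.C b * m := by
    refine hom_eq_of_C_mul hb0 ?_
    rw [hq₂, map_sub, iq₁', map_mul, hom_mvAeval iq iq₁, map_pow, map_mul, hom_C,
      hom_of_mem a θ F hFf]
  refine ⟨iq, iq₁, iq₂, ?_⟩
  set q₁ : Poly2 R := aeval (y R) ρ + MvPolynomial.C b * (x R + w) with hq₁def
  set q₂ : Poly2 R := (x R + w) ^ p + α * (x R + w) + β + MvPolynomial.C b * m with hq₂def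
  have hΛ : MvPolynomial.aeval ![q p a F, q₁, q₂] (Lambda p b ρ lam nu) = 0 := by
    have e : ∀ P : MvPolynomial (Fin 2) R, MvPolynomial.aeval ![q p a F, q₁, q₂]
        (MvPolynomial.aeval ![(MvPolynomial.X 0 : Poly3 R), MvPolynomial.X 1] P)
          = MvPolynomial.aeval ![q p a F, q₁] P := by
      intro P
      rw [← AlgHom.comp_apply]
      congr 1
      refine MvPolynomial.algHom_ext fun i => ?_
      fin_cases i <;> simp
    have hbp : b ^ p = b ^ (p - 1) * b := by rw [← pow_succ, Nat.sub_add_cancel hp]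
    rw [Lambda, map_add, map_sub, map_add, map_mul, map_mul, map_mul, e, e, ← hnu,
      ← aeval_algHom_apply, hbp, MvPolynomial.C_mul,
      map_mul (MvPolynomial.aeval ![q p a F, q₁, q₂]), map_pow (MvPolynomial.aeval _) _ p]
    simp only [MvPolynomial.aeval_X, MvPolynomial.aeval_C, MvPolynomial.algebraMap_eq,
      Matrix.cons_val_zero, Matrix.cons_val_one, Matrix.cons_val]
    -- Multiplying the equation for `q₂` by `b^(p-1)` and eliminating `q₁'` gives exactly `Λ(q, q₁,
    -- q₂) = 0`.
    linear_combination MvPolynomial.C (b ^ (p - 1)) * hq₂ + hq₁'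
  have hadj : invariants (aut a ha θ F hFf) = Algebra.adjoin R {q p a F, q₁, q₂} := by
    apply le_antisymm
    · intro g hg
      rw [mem_invariants_iff] at hg
      have h0 : q p a F ∈ Algebra.adjoin R {q p a F, q₁, q₂} := Algebra.subset_adjoin (by simp)
      have h1 : q₁ ∈ Algebra.adjoin R {q p a F, q₁, q₂} := Algebra.subset_adjoin (by simp)
      obtain ⟨N, hN⟩ := exists_C_pow_mul_mem_of_hom_eq ha hF hFf _
        (f_mem_of_C_mul_eq hq₁ _ h0 h1) h0 hg
      rw [← range_vec3, Algebra.adjoin_range_eq_range_aeval] at hN ⊢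
      refine mem_range_of_C_mul_mem_range _ ha ?_ (dvd_refl (a ^ N)) hN
      intro ϖ hϖ hϖa h hh
      exact exists_aeval_eq_C_mul hϖ hϖa
        (fun hϖb => hd.map_derivative_ne_zero hp ha hθ₀ hab hρ hϖ hϖb) hw hα hβ hq₂def lam nu hΛ hh
    · rw [Algebra.adjoin_le_iff]
      rintro g (rfl | rfl | rfl)
      · exact iq
      · exact iq₁
      · exact iq₂
  have hval : ∀ h : Poly3 R, ((MvPolynomial.aeval ![⟨q p a F, iq⟩, ⟨q₁, iq₁⟩, ⟨q₂, iq₂⟩] :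
      Poly3 R →ₐ[R] invariants (aut a ha θ F hFf)) h : Poly2 R)
        = MvPolynomial.aeval ![q p a F, q₁, q₂] h := by
    intro h
    rw [← Subalgebra.coe_val, ← AlgHom.comp_apply]
    congr 1
    refine MvPolynomial.algHom_ext fun i => ?_
    fin_cases i <;> simp
  have hker : RingHom.ker (MvPolynomial.aeval ![⟨q p a F, iq⟩, ⟨q₁, iq₁⟩, ⟨q₂, iq₂⟩] :
      Poly3 R →ₐ[R] invariants (aut a ha θ F hFf)) = Ideal.span {Lambda p b ρ lam nu} := by
    ext h
    rw [RingHom.mem_ker, Ideal.mem_span_singleton, ← Subtype.coe_inj, hval]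
    constructor
    · intro h0
      exact Lambda_dvd_of_aeval_eq_zero hp2 hb0 ρ lam nu hinj hΛ h0
    · rintro ⟨G, rfl⟩
      rw [map_mul, hΛ, zero_mul]
      rfl
  refine ⟨hadj, hker, ⟨?_⟩⟩
  have hsurj : Function.Surjective (MvPolynomial.aeval ![⟨q p a F, iq⟩, ⟨q₁, iq₁⟩, ⟨q₂, iq₂⟩] :
      Poly3 R →ₐ[R] invariants (aut a ha θ F hFf)) := by
    rintro ⟨g, hg⟩
    have hg' := hg
    rw [hadj, ← range_vec3, Algebra.adjoin_range_eq_range_aeval] at hg'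
    obtain ⟨h, hh⟩ := hg'
    exact ⟨h, Subtype.ext ((hval h).trans hh)⟩
  exact ((Ideal.quotientEquivAlgOfEq R hker.symm).trans
    (Ideal.quotientKerAlgEquivOfSurjective hsurj)).symm
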